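/- Let $k,d,m\ge 1$ be integers, $R,\varepsilon>0$, and let $\mathcal B(R)=\{t\in\mathbb R^d:\|t\|_2\le R\}$. Write $\theta=(a,t)=(a_1,\dots,a_k,t_1,\dots,t_k)\in\mathbb R^{k(d+1)}$ ($a_i\in\mathbb R$, $t_i\in\mathbb R^d$, Euclidean norm) and $\phi(\theta)=\sum_{i=1}^k a_i\delta_{t_i}$. For $\eta>0$ let $\Theta_{k,\eta}$ be the set of $\theta$ with all $t_i\in\mathcal B(R)$ and $\|t_i-t_j\|_2>\eta$ for $i\ne j$, and $\Sigma_{k,\eta}=\phi(\Theta_{k,\eta})$. *Measurements.* Let $\alpha_1,\dots,\alpha_m:\mathcal B(R)\to\mathbb C$ be $C^2$, $(Au)_l=\int\alpha_l\,du$ for signed measures $u$, and let $D_{A,R}=\sup|\langle v,\nabla^2\alpha_l(t)w\rangle|$, the supremum over $1\le l\le m$, $t\in\mathcal B(R)$ and unit vectors $v,w$. *Kernel.* Let $h(t,s)=\rho(\|t-s\|_2)$ be a $C^2$ kernel on $\mathbb R^d$ with $\rho\in C^2(\mathbb R)$, $\rho(0)=1=\max|h|$, $\rho'(0)=0$, $\rho''(0)<0$,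 and let $0<c_h\le\varepsilon/2$ be such that $\rho(t)\ge 1-\frac{|\rho''(0)|}{2}t^2$ for $t\in[0,c_h]$. Put $\langle\pi_1,\pi_2\rangle_h=\iint h\,d\pi_1d\pi_2$ and $\|\pi\|_h^2=\langle\pi,\pi\rangle_h$. Suppose $h$ has mutual coherence constant $\mu$ on $\frac\varepsilon2$-separated dipoles: $\langle\pi_1,\pi_2\rangle_h\le\mu\|\pi_1\|_h\|\pi_2\|_h$ whenever $\pi_1=b_1\delta_{s_1}-b_2\delta_{s_2}$ and $\pi_2=b_3\delta_{s_3}-b_4\delta_{s_4}$ with $\|s_1-s_2\|_2,\|s_3-s_4\|_2\le\frac\varepsilon2$ and $\|s_i-s_j\|_2>\frac\varepsilon2$ for $i\in\{1,2\}$, $j\in\{3,4\}$. Assume $(k-1)\mu<1$. *RIP.* Suppose that, with a constant $\gamma<1$, $(1-\gamma)\|x\|_h^2\le\|Ax\|_2^2\le(1+\gamma)\|x\|_h^2$ for all $x\in\Sigma_{k,\varepsilon/2}-\Sigma_{k,\varepsilon/2}$. *Noiseless minimization.* Let $y=Ax_0$ with $x_0\in\Sigma_{k,\varepsilon}$, let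 $g(\theta)=\|A\phi(\theta)-y\|_2^2$, and let $\theta^*=(a_1,\dots,a_k,t_1,\dots,t_k)$ be a minimizer of $g$ over $\Theta_{k,\varepsilon}$ with all $t_i$ in the interior of $\mathcal B(R)$ and $0<|a_1|\le\dots\le|a_k|$. Put $a^*=(a_1,\dots,a_k)$ and $$\beta_{\max}=\min\Big(c_h,\frac{|a_1|}2,C_1C_2\Big),\qquad C_1=\frac{(1-\gamma)(1-(k-1)\mu)}{(d+1)\sqrt{1+\gamma}\sqrt{1+(k-1)\mu}},$$ $$C_2=\frac{\min(1,|a_1|^2|\rho''(0)|/4)}{\max\big(|a_k|\sqrt m\,D_{A,R},\sqrt{1+\gamma}\sqrt{|\rho''(0)|}\big)\sqrt{1+2|\rho''(0)|\|a^*\|_2^2}}.$$ Assume $\beta_{\max}\le\varepsilon/4$ and that the open balls of radius $\beta_{\max}$ around the $t_i$ are contained in $\mathcal B(R)$. Then the open ball $\Lambda_{\theta^*,\beta_{\max}}=\{\theta:\|\theta-\theta^*\|_2<\beta_{\max}\}$ is a basin of attraction of $\theta^*$: it contains $\theta^*$, and there is a step $\tau>0$ such that for every $\theta_0\in\Lambda_{\theta^*,\beta_{\max}}$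 the gradient descent $\theta_{n+1}=\theta_n-\tau\nabla g(\theta_n)$ is well defined ($g$ is differentiable at every $\theta_n$) and converges to $\theta^*$. -/

import Mathlib

open MeasureTheory Filter Topology Set

noncomputable section

namespace SpikeEstimation

/-- The space `ℝ^d` of spike locations, with its Euclidean norm. -/
abbrev Loc (d : ℕ) := EuclideanSpace ℝ (Fin d)

/-- The parameter space `ℝ^{k(d+1)}` of pairs `θ = (a, t) = (a_1,…,a_k, t_1,…,t_k)` with the
Euclidean norm `‖θ‖² = ∑ |a_i|² + ∑ ‖t_i‖²`. The amplitude `a_i` is `θ.fst i`, the location `t_i`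
is `θ.snd i`. -/
abbrev Param (k d : ℕ) :=
  WithLp 2 (EuclideanSpace ℝ (Fin k) × PiLp 2 (fun _ : Fin k => Loc d))

/-! ### Sums of spikes -/

/-- The signed measure `φ(θ) = ∑ a_i δ_{t_i}` (`VectorMeasure.dirac t a` is `a δ_t`). -/
def phi {k d : ℕ} (θ : Param k d) : SignedMeasure (Loc d) :=
  ∑ i : Fin k, VectorMeasure.dirac (θ.snd i) (θ.fst i)

/-- `Θ_{k,ε}`: the parameters with locations in the closed ball of radius `R` which are pairwise
at distance more than `ε`. -/
def sepParams (k d : ℕ) (R ε : ℝ) : Set (Param k d) :=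
  {θ | (∀ i, ‖θ.snd i‖ ≤ R) ∧ ∀ i j, i ≠ j → ε < ‖θ.snd i - θ.snd j‖}

/-- `Σ_{k,ε}`: the sums of `k` Dirac masses with `ε`-separated locations in the ball. -/
def sepSpikes (k d : ℕ) (R ε : ℝ) : Set (SignedMeasure (Loc d)) :=
  phi '' sepParams k d R ε

/-! ### The measurement operator -/

/-- The measurement operator `(A u)_l = ∫ α_l du`, with values in `ℂ^m`. -/
def measOp {d m : ℕ} (α : Fin m → Loc d → ℂ) (u : SignedMeasure (Loc d)) :
    EuclideanSpace ℂ (Fin m) :=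
  WithLp.toLp 2 fun l => VectorMeasure.integral u (α l) (ContinuousLinearMap.lsmul ℝ ℝ).flip

/-- The objective function `g(θ) = ‖A φ(θ) - y‖₂²`. -/
def objective {k d m : ℕ} (α : Fin m → Loc d → ℂ) (y : EuclideanSpace ℂ (Fin m))
    (θ : Param k d) : ℝ :=
  ‖measOp α (phi θ) - y‖ ^ 2

/-- `D_{A,R}`: the supremum of the moduli of the second directional derivatives
`⟨v, ∇² α_l(t) w⟩` of the `α_l` over the closed ball of radius `R`. -/
def secondDerivBound {d m : ℕ} (α : Fin m → Loc d → ℂ) (R : ℝ) : ℝ :=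
  sSup {x : ℝ | ∃ (l : Fin m) (t v w : Loc d), ‖t‖ ≤ R ∧ ‖v‖ = 1 ∧ ‖w‖ = 1 ∧
    x = ‖iteratedFDerivWithin ℝ 2 (α l) (Metric.closedBall 0 R) t ![v, w]‖}

/-! ### Kernel, dipoles, mutual coherence, restricted isometry -/

/-- The translation invariant kernel `h(t, s) = ρ(‖t - s‖₂)`. -/
def kernel (ρ : ℝ → ℝ) {d : ℕ} (t s : Loc d) : ℝ := ρ ‖t - s‖

/-- The bilinear form `⟨π₁, π₂⟩_h = ∬ h(t, s) dπ₁(t) dπ₂(s)` on signed measures. -/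
def kernelInner (ρ : ℝ → ℝ) {d : ℕ} (π₁ π₂ : SignedMeasure (Loc d)) : ℝ :=
  VectorMeasure.integral π₂
    (fun s => VectorMeasure.integral π₁ (fun t => kernel ρ t s)
      (ContinuousLinearMap.lsmul ℝ ℝ).flip)
    (ContinuousLinearMap.lsmul ℝ ℝ).flip

/-- `‖π‖_h²`. -/
def kernelNormSq (ρ : ℝ → ℝ) {d : ℕ} (π : SignedMeasure (Loc d)) : ℝ := kernelInner ρ π π

/-- `‖π‖_h`. -/
def kernelNorm (ρ : ℝ → ℝ) {d : ℕ} (π : SignedMeasure (Loc d)) : ℝ :=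
  Real.sqrt (kernelNormSq ρ π)

/-- The regularity assumptions on the kernel `h(t, s) = ρ(‖t - s‖₂)` on `ℝ^d` at separation `ε`,
with the constant `c_h`. -/
structure KernelAssumption (ρ : ℝ → ℝ) (d : ℕ) (ε c_h : ℝ) : Prop where
  profile_contDiff : ContDiff ℝ 2 ρ
  kernel_contDiff : ContDiff ℝ 2 (fun p : Loc d × Loc d => kernel ρ p.1 p.2)
  profile_zero : ρ 0 = 1
  kernel_abs_le : ∀ t s : Loc d, |kernel ρ t s| ≤ 1
  deriv_zero : deriv ρ 0 = 0
  deriv2_neg : deriv (deriv ρ) 0 < 0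
  c_pos : 0 < c_h
  c_le : c_h ≤ ε / 2
  profile_ge : ∀ t ∈ Icc 0 c_h, 1 - |deriv (deriv ρ) 0| / 2 * t ^ 2 ≤ ρ t

/-- The measure `a₁ δ_{t₁} - a₂ δ_{t₂}`. -/
def dipole {d : ℕ} (a₁ a₂ : ℝ) (t₁ t₂ : Loc d) : SignedMeasure (Loc d) :=
  VectorMeasure.dirac t₁ a₁ - VectorMeasure.dirac t₂ a₂

/-- The kernel has mutual coherence constant `μ` on `η`-separated (`η`-)dipoles. -/
def MutualCoherence (ρ : ℝ → ℝ) (d : ℕ) (η μ : ℝ) : Prop :=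
  ∀ (a₁ a₂ a₃ a₄ : ℝ) (t₁ t₂ t₃ t₄ : Loc d),
    ‖t₁ - t₂‖ ≤ η → ‖t₃ - t₄‖ ≤ η →
    η < ‖t₁ - t₃‖ → η < ‖t₂ - t₃‖ → η < ‖t₁ - t₄‖ → η < ‖t₂ - t₄‖ →
    kernelInner ρ (dipole a₁ a₂ t₁ t₂) (dipole a₃ a₄ t₃ t₄) ≤
      μ * kernelNorm ρ (dipole a₁ a₂ t₁ t₂) * kernelNorm ρ (dipole a₃ a₄ t₃ t₄)

/-- `A` has the restricted isometry property with constant `γ` on the secant set `S - S`, with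
respect to `‖·‖_h`. -/
def HasRIP {d m : ℕ} (α : Fin m → Loc d → ℂ) (ρ : ℝ → ℝ) (S : Set (SignedMeasure (Loc d)))
    (γ : ℝ) : Prop :=
  ∀ x ∈ S, ∀ x' ∈ S,
    (1 - γ) * kernelNormSq ρ (x - x') ≤ ‖measOp α (x - x')‖ ^ 2 ∧
    ‖measOp α (x - x')‖ ^ 2 ≤ (1 + γ) * kernelNormSq ρ (x - x')

/-! ### Gradient descent and basins of attraction -/

/-- Fixed step gradient descent `θ_{n+1} = θ_n - τ ∇g(θ_n)` started at `θ₀`. -/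
def gradDescent {V : Type*} [NormedAddCommGroup V] [InnerProductSpace ℝ V] [CompleteSpace V]
    (g : V → ℝ) (τ : ℝ) (θ₀ : V) : ℕ → V
  | 0 => θ₀
  | n + 1 => gradDescent g τ θ₀ n - τ • gradient g (gradDescent g τ θ₀ n)

/-- `Λ` is a basin of attraction of `θ'` for `g`: it contains `θ'`, and for some fixed step `τ > 0`
gradient descent started anywhere in `Λ` is well defined (`g` is differentiable at all iterates)
and converges to `θ'`. -/
def IsBasinOfAttraction {V : Type*} [NormedAddCommGroup V] [InnerProductSpace ℝ V]
    [CompleteSpace V] (g : V → ℝ) (Λ : Set V) (θ' : V) : Prop :=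
  θ' ∈ Λ ∧ ∃ τ : ℝ, 0 < τ ∧ ∀ θ₀ ∈ Λ,
    (∀ n, DifferentiableAt ℝ g (gradDescent g τ θ₀ n)) ∧
    Tendsto (gradDescent g τ θ₀) atTop (𝓝 θ')

/-! ### The explicit radius -/

/-- `C₁ = (1-γ)(1-(k-1)μ) / ((d+1) √(1+γ) √(1+(k-1)μ))`. -/
def C₁ (k d : ℕ) (γ μ : ℝ) : ℝ :=
  ((1 - γ) * (1 - ((k : ℝ) - 1) * μ)) /
    (((d : ℝ) + 1) * Real.sqrt (1 + γ) * Real.sqrt (1 + ((k : ℝ) - 1) * μ))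

/-- `C₂ = min(1, |a_1|²|ρ''(0)|/4) /
(max(|a_k| √m D, √(1+γ) √|ρ''(0)|) √(1 + 2|ρ''(0)|‖a‖₂²))`, where `aMin`, `aMax` stand for `|a_1|`,
`|a_k|`, `r` for `ρ''(0)`, and `nrm` for `‖a‖₂`. -/
def C₂ (m : ℕ) (γ D r aMin aMax nrm : ℝ) : ℝ :=
  min 1 (aMin ^ 2 * |r| / 4) /
    (max (aMax * Real.sqrt m * D) (Real.sqrt (1 + γ) * Real.sqrt |r|) *
      Real.sqrt (1 + 2 * |r| * nrm ^ 2))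

/-- `β_max = min(c_h, |a_1|/2, C₁ C₂)`, for the amplitudes `a_1, …, a_k` of `θ`. -/
def betaMax {k d m : ℕ} (hk : 0 < k) (α : Fin m → Loc d → ℂ) (R : ℝ) (ρ : ℝ → ℝ)
    (γ μ c_h : ℝ) (θ : Param k d) : ℝ :=
  min c_h (min (|θ.fst ⟨0, hk⟩| / 2)
    (C₁ k d γ μ *
      C₂ m γ (secondDerivBound α R) (deriv (deriv ρ) 0)
        |θ.fst ⟨0, hk⟩| |θ.fst ⟨k - 1, Nat.sub_lt hk Nat.one_pos⟩| ‖θ.fst‖))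

end SpikeEstimation

end

open SpikeEstimation

/-! Write `F θ = ∑ a_i α(t_i)` for the measurements, so that g = ‖F - y‖². Because the data are
noiseless, the minimum over the feasible set is 0, so F(θ') = y; minimality serves no other purpose.

It then suffices to have, on the ball, one-point coercivity ⟨∇g(θ), θ - θ'⟩ ≥ c‖θ - θ'‖² and linear
growth ‖∇g(θ)‖ ≤ L‖θ - θ'‖: a small fixed step contracts the distance to θ'
(`isBasinOfAttraction_ball`). Coercivity follows from the mean value theorem on the segment from θ'
(`le_inner_gradient_of_segment`) once the Hessian form 2‖DF v‖² + 2⟨F - y, D²F(v, v)⟩ is bounded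
below.

Applied to difference quotients, the RIP bounds ‖DF v‖² on both sides by kernel norms of
infinitesimal dipoles, which mutual coherence makes almost orthogonal (`HasRIP.norm_spikeSumDeriv`).
Applied to φ(θ) - φ(θ'), it gives ‖F(θ) - y‖ ≤ S‖θ - θ'‖, while ‖D²F(v, v)‖ ≤ 2M‖v‖²
(`norm_spikeSumDeriv2_le`). On a ball of radius β the form is thus at least 2(Pq - 2SβM)‖v‖², and
the given radius makes this positive (`radius_slack`). -/

namespace SpikeEstimation

/-! ### Integrals against Dirac masses and dipoles -/

section Measures

variable {d k m : ℕ} {E : Type*} [NormedAddCommGroup E]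

theorem integrable_dirac_vectorMeasure (f : Loc d → E) (t : Loc d) (a : ℝ) :
    (VectorMeasure.dirac t a : SignedMeasure (Loc d)).Integrable f := by
  have h : (VectorMeasure.dirac t a : SignedMeasure (Loc d)).variation
      = ‖a‖₊ • Measure.dirac t := by
    rw [VectorMeasure.variation_dirac]; rfl
  unfold VectorMeasure.Integrable
  rw [h]
  exact (integrable_dirac (by simp)).smul_measure (by simp)

theorem integrable_dipole (f : Loc d → E) (a b : ℝ) (t s : Loc d) :
    (dipole a b t s).Integrable f :=
  (integrable_dirac_vectorMeasure f t a).sub_vectorMeasure (integrable_dirac_vectorMeasure f s b)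

variable [NormedSpace ℝ E] [CompleteSpace E]

theorem integral_dirac_vectorMeasure (f : Loc d → E) (t : Loc d) (a : ℝ) :
    VectorMeasure.integral (VectorMeasure.dirac t a : SignedMeasure (Loc d)) f
      (ContinuousLinearMap.lsmul ℝ ℝ).flip = a • f t := by
  rw [VectorMeasure.integral_dirac]; simp

theorem integral_dipole (f : Loc d → E) (a b : ℝ) (t s : Loc d) :
    VectorMeasure.integral (dipole a b t s) f (ContinuousLinearMap.lsmul ℝ ℝ).flip
      = a • f t - b • f s := by
  rw [dipole, VectorMeasure.integral_sub_vectorMeasure (integrable_dirac_vectorMeasure f t a)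
    (integrable_dirac_vectorMeasure f s b), integral_dirac_vectorMeasure,
    integral_dirac_vectorMeasure]

theorem integral_sum_dipole {ι : Type*} (S : Finset ι) (f : Loc d → E) (a b : ι → ℝ)
    (t s : ι → Loc d) :
    VectorMeasure.integral (∑ i ∈ S, dipole (a i) (b i) (t i) (s i)) f
      (ContinuousLinearMap.lsmul ℝ ℝ).flip = ∑ i ∈ S, (a i • f (t i) - b i • f (s i)) := by
  rw [VectorMeasure.integral_finsetSum_vectorMeasure fun i _ => integrable_dipole f _ _ _ _]
  exact Finset.sum_congr rfl fun i _ => integral_dipole _ _ _ _ _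

theorem phi_sub_phi (θ ξ : Param k d) :
    phi θ - phi ξ = ∑ i, dipole (θ.fst i) (ξ.fst i) (θ.snd i) (ξ.snd i) := by
  simp [phi, dipole, Finset.sum_sub_distrib]

theorem integral_phi (f : Loc d → E) (θ : Param k d) :
    VectorMeasure.integral (phi θ) f (ContinuousLinearMap.lsmul ℝ ℝ).flip
      = ∑ i, θ.fst i • f (θ.snd i) := by
  rw [phi, VectorMeasure.integral_finsetSum_vectorMeasure
    fun i _ => integrable_dirac_vectorMeasure f _ _]
  exact Finset.sum_congr rfl fun i _ => integral_dirac_vectorMeasure _ _ _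

/-- The measurement vector of a unit spike. -/
noncomputable def spikeMeas (α : Fin m → Loc d → ℂ) (t : Loc d) : EuclideanSpace ℂ (Fin m) :=
  WithLp.toLp 2 fun l => α l t

theorem measOp_phi (α : Fin m → Loc d → ℂ) (θ : Param k d) :
    measOp α (phi θ) = ∑ i, θ.fst i • spikeMeas α (θ.snd i) := by
  ext l
  simp [measOp, integral_phi, spikeMeas]

theorem measOp_phi_sub (α : Fin m → Loc d → ℂ) (θ ξ : Param k d) :
    measOp α (phi θ - phi ξ) = measOp α (phi θ) - measOp α (phi ξ) := by
  ext l
  simp [measOp, phi_sub_phi, integral_sum_dipole, integral_phi, Finset.sum_sub_distrib]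

/-- The value of `kernelInner` on a pair of dipoles. -/
theorem kernelInner_dipole (ρ : ℝ → ℝ) (a b a' b' : ℝ) (t s t' s' : Loc d) :
    kernelInner ρ (dipole a b t s) (dipole a' b' t' s')
      = a' * (a * ρ ‖t - t'‖ - b * ρ ‖s - t'‖) - b' * (a * ρ ‖t - s'‖ - b * ρ ‖s - s'‖) := by
  simp [kernelInner, integral_dipole, kernel]

theorem kernelInner_sum_dipole {ι : Type*} (S : Finset ι) (ρ : ℝ → ℝ) (a b : ι → ℝ)
    (t s : ι → Loc d) :
    kernelNormSq ρ (∑ i ∈ S, dipole (a i) (b i) (t i) (s i))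
      = ∑ j ∈ S, ∑ i ∈ S, kernelInner ρ (dipole (a i) (b i) (t i) (s i))
          (dipole (a j) (b j) (t j) (s j)) := by
  unfold kernelNormSq kernelInner
  simp only [integral_sum_dipole, integral_dipole, smul_eq_mul]
  refine Finset.sum_congr rfl fun j _ => ?_
  rw [Finset.mul_sum, Finset.mul_sum, ← Finset.sum_sub_distrib]

/-- `‖a δ_t - b δ_s‖_h²` as a function of `a`, `b` and `r = ‖t - s‖`. -/
noncomputable def dipoleSq (ρ : ℝ → ℝ) (a b r : ℝ) : ℝ := (a - b) ^ 2 + 2 * (a * b) * (1 - ρ r)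

theorem kernelNormSq_dipole {ρ : ℝ → ℝ} (h0 : ρ 0 = 1) (a b : ℝ) (t s : Loc d) :
    kernelNormSq ρ (dipole a b t s) = dipoleSq ρ a b ‖t - s‖ := by
  rw [kernelNormSq, kernelInner_dipole, norm_sub_rev s t, sub_self, sub_self, norm_zero, h0,
    dipoleSq]
  ring

/-- The bound |ρ| ≤ 1 replaces positive definiteness of the kernel, which is not assumed: a² + b² -
2abρ lies between (a - b)² and (a + b)². -/
theorem dipoleSq_nonneg {ρ : ℝ → ℝ} {r : ℝ} (h : |ρ r| ≤ 1) (a b : ℝ) : 0 ≤ dipoleSq ρ a b r := by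
  obtain ⟨h1, h2⟩ := abs_le.1 h
  unfold dipoleSq
  rcases le_total 0 (a * b) with hab | hab
  · have := mul_nonneg hab (sub_nonneg.2 h2)
    nlinarith [sq_nonneg (a - b)]
  · have := mul_nonneg (neg_nonneg.2 hab) (by linarith : 0 ≤ 1 + ρ r)
    nlinarith [sq_nonneg (a + b)]

end Measures

/-! ### Almost orthogonality of separated dipoles -/

section Coherence

variable {d k m : ℕ} {ρ : ℝ → ℝ} {η μ : ℝ}

/-- Negating one dipole flips the sign of the inner product and keeps the norm, so the one-sided
coherence bound is two-sided. -/
theorem MutualCoherence.abs_le (h : MutualCoherence ρ d η μ) (h0 : ρ 0 = 1)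
    (a b a' b' : ℝ) {t s t' s' : Loc d} (h1 : ‖t - s‖ ≤ η)
    (h2 : ‖t' - s'‖ ≤ η) (h3 : η < ‖t - t'‖) (h4 : η < ‖s - t'‖) (h5 : η < ‖t - s'‖)
    (h6 : η < ‖s - s'‖) :
    |kernelInner ρ (dipole a b t s) (dipole a' b' t' s')| ≤
      μ * (√(dipoleSq ρ a b ‖t - s‖) * √(dipoleSq ρ a' b' ‖t' - s'‖)) := by
  have e1 := h a b a' b' t s t' s' h1 h2 h3 h4 h5 h6
  have e2 := h (-a) (-b) a' b' t s t' s' h1 h2 h3 h4 h5 h6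
  simp only [kernelNorm, kernelNormSq_dipole h0, mul_assoc] at e1 e2
  have e3 : dipoleSq ρ (-a) (-b) ‖t - s‖ = dipoleSq ρ a b ‖t - s‖ := by
    unfold dipoleSq; ring
  rw [e3] at e2
  refine abs_le'.2 ⟨e1, le_trans (le_of_eq ?_) e2⟩
  simp only [kernelInner_dipole]
  ring

/-- The left side is (∑ x)² - ∑ x², and Cauchy–Schwarz bounds (∑ x)². This is the source of the
factor k - 1. -/
theorem sum_offDiag_mul_le {ι : Type*} [Fintype ι] [DecidableEq ι] (x : ι → ℝ) :
    ∑ j, ∑ i, (if i = j then 0 else x i * x j) ≤ ((Fintype.card ι : ℝ) - 1) * ∑ i, x i ^ 2 := by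
  have h : ∀ j, ∑ i, (if i = j then 0 else x i * x j) = (∑ i, x i) * x j - x j ^ 2 := by
    intro j
    rw [Finset.sum_mul, eq_sub_iff_add_eq, ← (Finset.sum_ite_eq' Finset.univ j
      (fun i => x i ^ 2)).trans (if_pos (Finset.mem_univ j)), ← Finset.sum_add_distrib]
    refine Finset.sum_congr rfl fun i _ => ?_
    split_ifs with hij
    · subst hij; ring
    · ring
  simp_rw [h]
  rw [Finset.sum_sub_distrib, ← Finset.mul_sum]
  have := sq_sum_le_card_mul_sum_sq (s := Finset.univ) (f := x)
  rw [Finset.card_univ] at this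
  nlinarith

/-- Bounds for the kernel norm of a sum of pairwise separated dipoles. -/
theorem abs_kernelNormSq_phi_sub_le (h : MutualCoherence ρ d η μ) (h0 : ρ 0 = 1)
    (hρ : ∀ t s : Loc d, |kernel ρ t s| ≤ 1) (hμ0 : 1 < k → 0 ≤ μ) {θ ξ : Param k d}
    (h1 : ∀ i, ‖θ.snd i - ξ.snd i‖ ≤ η) (h2 : ∀ i j, i ≠ j → η < ‖θ.snd i - θ.snd j‖)
    (h3 : ∀ i j, i ≠ j → η < ‖ξ.snd i - ξ.snd j‖) (h4 : ∀ i j, i ≠ j → η < ‖θ.snd i - ξ.snd j‖) :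
    |kernelNormSq ρ (phi θ - phi ξ)
      - ∑ i, dipoleSq ρ (θ.fst i) (ξ.fst i) ‖θ.snd i - ξ.snd i‖| ≤
    ((k : ℝ) - 1) * μ * ∑ i, dipoleSq ρ (θ.fst i) (ξ.fst i) ‖θ.snd i - ξ.snd i‖ := by
  have hn : ∀ i, 0 ≤ dipoleSq ρ (θ.fst i) (ξ.fst i) ‖θ.snd i - ξ.snd i‖ :=
    fun i => dipoleSq_nonneg (hρ _ _) _ _
  set x : Fin k → ℝ := fun i => √(dipoleSq ρ (θ.fst i) (ξ.fst i) ‖θ.snd i - ξ.snd i‖)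
  have hx2 : ∀ i, dipoleSq ρ (θ.fst i) (ξ.fst i) ‖θ.snd i - ξ.snd i‖ = x i ^ 2 :=
    fun i => (Real.sq_sqrt (hn i)).symm
  have key : kernelNormSq ρ (phi θ - phi ξ)
      - ∑ i, dipoleSq ρ (θ.fst i) (ξ.fst i) ‖θ.snd i - ξ.snd i‖
      = ∑ j, ∑ i, (if i = j then 0 else kernelInner ρ
        (dipole (θ.fst i) (ξ.fst i) (θ.snd i) (ξ.snd i))
        (dipole (θ.fst j) (ξ.fst j) (θ.snd j) (ξ.snd j))) := by
    rw [phi_sub_phi, kernelInner_sum_dipole, ← Finset.sum_sub_distrib]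
    refine Finset.sum_congr rfl fun j _ => ?_
    rw [← kernelNormSq_dipole h0, kernelNormSq, sub_eq_iff_eq_add,
      ← Finset.sum_ite_eq' Finset.univ j (fun i => kernelInner ρ
        (dipole (θ.fst i) (ξ.fst i) (θ.snd i) (ξ.snd i))
        (dipole (θ.fst i) (ξ.fst i) (θ.snd i) (ξ.snd i))) |>.trans (if_pos (Finset.mem_univ j)),
      ← Finset.sum_add_distrib]
    refine Finset.sum_congr rfl fun i _ => ?_
    split_ifs with hij
    · subst hij; simp
    · simp
  rw [key]
  simp_rw [hx2]
  have step : ∀ j i, |(if i = j then 0 else kernelInner ρ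
        (dipole (θ.fst i) (ξ.fst i) (θ.snd i) (ξ.snd i))
        (dipole (θ.fst j) (ξ.fst j) (θ.snd j) (ξ.snd j)))| ≤
        μ * (if i = j then 0 else x i * x j) := by
    intro j i
    split_ifs with hij
    · simp
    · refine h.abs_le h0 _ _ _ _ (h1 i) (h1 j) (h2 i j hij) ?_ (h4 i j hij) (h3 i j hij)
      rw [norm_sub_rev]
      exact h4 j i (Ne.symm hij)
  calc _ ≤ ∑ j, ∑ i, μ * (if i = j then 0 else x i * x j) := by
        refine (Finset.abs_sum_le_sum_abs _ _).trans (Finset.sum_le_sum fun j _ => ?_)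
        exact (Finset.abs_sum_le_sum_abs _ _).trans (Finset.sum_le_sum fun i _ => step j i)
    _ = μ * ∑ j, ∑ i, (if i = j then 0 else x i * x j) := by simp only [Finset.mul_sum]
    _ ≤ _ := by
        rcases Nat.lt_or_ge 1 k with hk | hk
        · have := mul_le_mul_of_nonneg_left (sum_offDiag_mul_le x) (hμ0 hk)
          rw [Fintype.card_fin] at this
          linarith
        -- With at most one dipole there are no cross terms, so the sign of μ is irrelevant.
        · have hz : ∀ j i : Fin k, i = j := fun j i => by
            ext; omega
          have hk' : ((k : ℝ) - 1) * ∑ i, x i ^ 2 = 0 := by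
            interval_cases k <;> simp
          rw [mul_assoc, mul_left_comm, hk']
          have hz' : ∀ j i : Fin k, (if i = j then 0 else x i * x j) = 0 :=
            fun j i => if_pos (hz j i)
          simp [hz']

end Coherence

/-! ### Convergence of gradient descent -/

section Descent

variable {V : Type*} [NormedAddCommGroup V] [InnerProductSpace ℝ V] [CompleteSpace V]

/-- Gradient descent converges linearly on a ball on which the gradient is coercive and of linear
growth with respect to the centre. -/
theorem isBasinOfAttraction_ball {g : V → ℝ} {x : V} {r c L : ℝ} (hr : 0 < r) (hc : 0 < c)
    (hd : ∀ z ∈ Metric.ball x r, DifferentiableAt ℝ g z)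
    (hlow : ∀ z ∈ Metric.ball x r, c * ‖z - x‖ ^ 2 ≤ inner ℝ (gradient g z) (z - x))
    (hup : ∀ z ∈ Metric.ball x r, ‖gradient g z‖ ≤ L * ‖z - x‖) :
    IsBasinOfAttraction g (Metric.ball x r) x := by
  refine ⟨Metric.mem_ball_self hr, c / (L ^ 2 + c ^ 2), by positivity, fun z₀ hz₀ => ?_⟩
  set τ := c / (L ^ 2 + c ^ 2) with hτ
  have hτ0 : 0 < τ := by positivity
  set q := 1 - c ^ 2 / (L ^ 2 + c ^ 2)
  have hq1 : q < 1 := by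
    have : 0 < c ^ 2 / (L ^ 2 + c ^ 2) := by positivity
    linarith
  have hq0 : 0 ≤ q := by
    have : c ^ 2 / (L ^ 2 + c ^ 2) ≤ 1 := (div_le_one (by positivity)).2 (by nlinarith)
    linarith
  -- The contraction factor for squared distances. Adding c² to the denominator of τ keeps q
  -- nonnegative and covers L = 0.
  have hτq : 1 - 2 * τ * c + τ ^ 2 * L ^ 2 ≤ q := by
    have e1 : τ ^ 2 * (L ^ 2 + c ^ 2) = c ^ 2 / (L ^ 2 + c ^ 2) := by
      rw [hτ]; field_simp
    have e2 : τ * c = c ^ 2 / (L ^ 2 + c ^ 2) := by rw [hτ]; ring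
    nlinarith [sq_nonneg (τ * c)]
  have step : ∀ z ∈ Metric.ball x r, ‖z - τ • gradient g z - x‖ ^ 2 ≤ q * ‖z - x‖ ^ 2 := by
    intro z hz
    have h1 : z - τ • gradient g z - x = (z - x) - τ • gradient g z := by abel
    rw [h1, norm_sub_sq_real, inner_smul_right, norm_smul, Real.norm_of_nonneg hτ0.le,
      real_inner_comm]
    have h2 := mul_le_mul_of_nonneg_left (hlow z hz) hτ0.le
    have h3 : ‖gradient g z‖ ^ 2 ≤ L ^ 2 * ‖z - x‖ ^ 2 := by
      rw [← mul_pow]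
      exact pow_le_pow_left₀ (norm_nonneg _) (hup z hz) 2
    have h4 := mul_le_mul_of_nonneg_left h3 (sq_nonneg τ)
    have h5 := mul_le_mul_of_nonneg_right hτq (sq_nonneg ‖z - x‖)
    nlinarith
  have hind : ∀ n, gradDescent g τ z₀ n ∈ Metric.ball x r ∧
      ‖gradDescent g τ z₀ n - x‖ ^ 2 ≤ q ^ n * ‖z₀ - x‖ ^ 2 := by
    intro n
    induction n with
    | zero => exact ⟨hz₀, by simp [gradDescent]⟩
    | succ n ih =>
      have h := step _ ih.1
      rw [show gradDescent g τ z₀ (n + 1) = gradDescent g τ z₀ n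
        - τ • gradient g (gradDescent g τ z₀ n) from rfl]
      refine ⟨?_, ?_⟩
      · have h' := ih.1
        rw [mem_ball_iff_norm] at h' ⊢
        refine lt_of_le_of_lt (le_of_sq_le_sq ?_ (norm_nonneg _)) h'
        exact h.trans (mul_le_of_le_one_left (sq_nonneg _) hq1.le)
      · rw [pow_succ' q, mul_assoc]
        exact h.trans (mul_le_mul_of_nonneg_left ih.2 hq0)
  refine ⟨fun n => hd _ (hind n).1, ?_⟩
  rw [tendsto_iff_norm_sub_tendsto_zero]
  have h0 : Tendsto (fun n => q ^ n * ‖z₀ - x‖ ^ 2) atTop (𝓝 0) := by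
    simpa using (tendsto_pow_atTop_nhds_zero_of_lt_one hq0 hq1).mul_const (‖z₀ - x‖ ^ 2)
  have h1 := squeeze_zero (fun n => sq_nonneg _) (fun n => (hind n).2) h0
  have h2 := h1.sqrt
  simpa [Real.sqrt_sq (norm_nonneg _)] using h2

end Descent

/-! ### Derivatives of spike sums along lines -/

section Calculus

variable {d k : ℕ} {E : Type*} [NormedAddCommGroup E] [NormedSpace ℝ E]

theorem norm_sq_param (θ : Param k d) : ‖θ‖ ^ 2 = ∑ i, θ.fst i ^ 2 + ∑ i, ‖θ.snd i‖ ^ 2 := by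
  rw [WithLp.prod_norm_sq_eq_of_L2, EuclideanSpace.norm_sq_eq, PiLp.norm_sq_eq_of_L2]
  simp

theorem abs_fst_le_norm (θ : Param k d) (i : Fin k) : |θ.fst i| ≤ ‖θ‖ := by
  refine abs_le_of_sq_le_sq ?_ (norm_nonneg _)
  rw [norm_sq_param]
  have h1 := Finset.single_le_sum (f := fun i => θ.fst i ^ 2) (fun i _ => sq_nonneg _)
    (Finset.mem_univ i)
  have h2 : 0 ≤ ∑ i, ‖θ.snd i‖ ^ 2 := by positivity
  linarith

theorem norm_snd_le_norm (θ : Param k d) (i : Fin k) : ‖θ.snd i‖ ≤ ‖θ‖ := by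
  refine le_of_sq_le_sq ?_ (norm_nonneg _)
  rw [norm_sq_param]
  have h1 := Finset.single_le_sum (f := fun i => ‖θ.snd i‖ ^ 2) (fun i _ => sq_nonneg _)
    (Finset.mem_univ i)
  have h2 : 0 ≤ ∑ i, θ.fst i ^ 2 := by positivity
  linarith

/-- The sum `∑ a_i f(t_i)`. -/
noncomputable def spikeSum (f : Loc d → E) (θ : Param k d) : E := ∑ i, θ.fst i • f (θ.snd i)

/-- The directional derivative of `spikeSum f` at `θ` in direction `v`. -/
noncomputable def spikeSumDeriv (f : Loc d → E) (θ v : Param k d) : E :=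
  ∑ i, (v.fst i • f (θ.snd i) + θ.fst i • fderiv ℝ f (θ.snd i) (v.snd i))

/-- The second directional derivative of `spikeSum f` at `θ` in direction `v`. -/
noncomputable def spikeSumDeriv2 (f : Loc d → E) (θ v : Param k d) : E :=
  ∑ i, ((2 * v.fst i) • fderiv ℝ f (θ.snd i) (v.snd i) +
    θ.fst i • fderiv ℝ (fderiv ℝ f) (θ.snd i) (v.snd i) (v.snd i))

theorem fst_add_smul (θ v : Param k d) (s : ℝ) (i : Fin k) :
    (θ + s • v).fst i = θ.fst i + s * v.fst i := by simp

theorem snd_add_smul (θ v : Param k d) (s : ℝ) (i : Fin k) :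
    (θ + s • v).snd i = θ.snd i + s • v.snd i := by simp

theorem hasDerivAt_affine (a b s : ℝ) : HasDerivAt (fun s : ℝ => a + s * b) b s := by
  simpa using ((hasDerivAt_id s).mul_const b).const_add a

theorem hasDerivAt_smul_comp_line {H : Type*} [NormedAddCommGroup H] [NormedSpace ℝ H] {f : H → E}
    {t u : H} {a b s : ℝ} (h : DifferentiableAt ℝ f (t + s • u)) :
    HasDerivAt (fun s : ℝ => (a + s * b) • f (t + s • u))
      (b • f (t + s • u) + (a + s * b) • fderiv ℝ f (t + s • u) u) s := by
  have h2 : HasDerivAt (fun s : ℝ => t + s • u) u s := by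
    simpa using ((hasDerivAt_id s).smul_const u).const_add t
  rw [add_comm]
  exact (hasDerivAt_affine a b s).smul (h.hasFDerivAt.comp_hasDerivAt s h2)

theorem hasDerivAt_smul_comp_line' {H : Type*} [NormedAddCommGroup H] [NormedSpace ℝ H]
    {f : H → E} {t u : H} {a b s : ℝ} (h : ContDiffAt ℝ 2 f (t + s • u)) :
    HasDerivAt (fun s : ℝ => b • f (t + s • u) + (a + s * b) • fderiv ℝ f (t + s • u) u)
      ((2 * b) • fderiv ℝ f (t + s • u) u +
        (a + s * b) • fderiv ℝ (fderiv ℝ f) (t + s • u) u u) s := by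
  have h2 : HasDerivAt (fun s : ℝ => t + s • u) u s := by
    simpa using ((hasDerivAt_id s).smul_const u).const_add t
  have h3 := (h.differentiableAt (by norm_num)).hasFDerivAt.comp_hasDerivAt s h2
  have h4 : DifferentiableAt ℝ (fderiv ℝ f) (t + s • u) :=
    (h.fderiv_right (m := 1) (by norm_num)).differentiableAt (by norm_num)
  have h5 := h4.hasFDerivAt.comp_hasDerivAt s h2
  have h6 := (ContinuousLinearMap.apply ℝ E u).hasFDerivAt.comp_hasDerivAt s h5
  have h7 := (h3.const_smul b).add ((hasDerivAt_affine a b s).smul h6)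
  refine h7.congr_deriv ?_
  simp only [Function.comp_apply, ContinuousLinearMap.apply_apply, two_mul, add_smul]
  abel

theorem hasDerivAt_spikeSum {f : Loc d → E} {θ v : Param k d} {s : ℝ}
    (h : ∀ i, DifferentiableAt ℝ f ((θ + s • v).snd i)) :
    HasDerivAt (fun s : ℝ => spikeSum f (θ + s • v)) (spikeSumDeriv f (θ + s • v) v) s := by
  simp only [spikeSum, spikeSumDeriv, fst_add_smul, snd_add_smul] at h ⊢
  exact HasDerivAt.fun_sum fun i _ => hasDerivAt_smul_comp_line (h i)

theorem hasDerivAt_spikeSumDeriv {f : Loc d → E} {θ v : Param k d} {s : ℝ}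
    (h : ∀ i, ContDiffAt ℝ 2 f ((θ + s • v).snd i)) :
    HasDerivAt (fun s : ℝ => spikeSumDeriv f (θ + s • v) v)
      (spikeSumDeriv2 f (θ + s • v) v) s := by
  simp only [spikeSumDeriv, spikeSumDeriv2, fst_add_smul, snd_add_smul] at h ⊢
  exact HasDerivAt.fun_sum fun i _ => hasDerivAt_smul_comp_line' (h i)

theorem differentiableAt_spikeSum {f : Loc d → E} {θ : Param k d}
    (h : ∀ i, DifferentiableAt ℝ f (θ.snd i)) : DifferentiableAt ℝ (spikeSum f) θ := by
  unfold spikeSum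
  refine DifferentiableAt.fun_sum fun i _ => ?_
  have h1 : DifferentiableAt ℝ (fun θ : Param k d => θ.fst i) θ :=
    ((EuclideanSpace.proj (𝕜 := ℝ) i : EuclideanSpace ℝ (Fin k) →L[ℝ] ℝ).comp
      (WithLp.fstL 2 ℝ _ _)).differentiableAt
  have h2 : DifferentiableAt ℝ (fun θ : Param k d => θ.snd i) θ :=
    ((PiLp.proj (𝕜 := ℝ) 2 (fun _ : Fin k => Loc d) i).comp
      (WithLp.sndL 2 ℝ _ _)).differentiableAt
  exact h1.smul ((h i).comp θ h2)

theorem fderiv_spikeSum {f : Loc d → E} {θ : Param k d}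
    (h : ∀ i, DifferentiableAt ℝ f (θ.snd i)) (v : Param k d) :
    fderiv ℝ (spikeSum f) θ v = spikeSumDeriv f θ v := by
  have h1 := (differentiableAt_spikeSum h).hasFDerivAt.hasLineDerivAt v
  have h2 := hasDerivAt_spikeSum (f := f) (θ := θ) (v := v) (s := 0) (by simpa using h)
  rw [zero_smul, add_zero] at h2
  exact HasDerivAt.unique h1 h2

end Calculus

/-! ### Gradient of the squared residual -/

section LeastSquares

variable {d k : ℕ} {E : Type*} [NormedAddCommGroup E] [InnerProductSpace ℝ E]

theorem inner_gradient_normSq_sub {V : Type*} [NormedAddCommGroup V] [InnerProductSpace ℝ V]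
    [CompleteSpace V] {G : V → E} {G' : V →L[ℝ] E} {x : V} (h : HasFDerivAt G G' x) (y : E) (v : V) :
    inner ℝ (gradient (fun x => ‖G x - y‖ ^ 2) x) v = 2 * inner ℝ (G x - y) (G' v) := by
  rw [inner_gradient_left, (h.sub_const y).norm_sq.fderiv]
  simp [inner_sub_left]

theorem inner_gradient_normSq_spikeSum_sub {f : Loc d → E} {y : E} {θ : Param k d}
    (h : ∀ i, DifferentiableAt ℝ f (θ.snd i)) (v : Param k d) :
    inner ℝ (gradient (fun θ => ‖spikeSum f θ - y‖ ^ 2) θ) v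
      = 2 * inner ℝ (spikeSum f θ - y) (spikeSumDeriv f θ v) := by
  rw [← fderiv_spikeSum h]
  exact inner_gradient_normSq_sub (differentiableAt_spikeSum h).hasFDerivAt y v

/-- If the residual vanishes at `θ'` and the second directional derivatives of the squared residual
along the segment from `θ'` to `θ` are bounded below, its gradient at `θ` is coercive. -/
theorem le_inner_gradient_of_segment {f : Loc d → E} {y : E} {θ' θ : Param k d} {c : ℝ}
    (hy : spikeSum f θ' = y)
    (hf : ∀ s ∈ Icc (0 : ℝ) 1, ∀ i, ContDiffAt ℝ 2 f ((θ' + s • (θ - θ')).snd i))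
    (hc : ∀ s ∈ Icc (0 : ℝ) 1, c ≤ 2 * ‖spikeSumDeriv f (θ' + s • (θ - θ')) (θ - θ')‖ ^ 2
      + 2 * inner ℝ (spikeSum f (θ' + s • (θ - θ')) - y)
        (spikeSumDeriv2 f (θ' + s • (θ - θ')) (θ - θ'))) :
    c ≤ inner ℝ (gradient (fun θ => ‖spikeSum f θ - y‖ ^ 2) θ) (θ - θ') := by
  have h1 : θ' + (1 : ℝ) • (θ - θ') = θ := by simp
  have hfθ : ∀ i, DifferentiableAt ℝ f (θ.snd i) := fun i => by
    have := hf 1 (by simp) i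
    rw [h1] at this
    exact this.differentiableAt (by norm_num)
  rw [inner_gradient_normSq_spikeSum_sub hfθ]
  have hD : ∀ s ∈ Icc (0 : ℝ) 1, HasDerivAt
      (fun s : ℝ => 2 * inner ℝ (spikeSum f (θ' + s • (θ - θ')) - y)
        (spikeSumDeriv f (θ' + s • (θ - θ')) (θ - θ')))
      (2 * ‖spikeSumDeriv f (θ' + s • (θ - θ')) (θ - θ')‖ ^ 2
      + 2 * inner ℝ (spikeSum f (θ' + s • (θ - θ')) - y)
        (spikeSumDeriv2 f (θ' + s • (θ - θ')) (θ - θ'))) s := by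
    intro s hs
    have e1 := (hasDerivAt_spikeSum
      (fun i => (hf s hs i).differentiableAt (by norm_num))).sub_const y
    have e2 := (e1.inner ℝ (hasDerivAt_spikeSumDeriv (hf s hs))).const_mul 2
    refine e2.congr_deriv ?_
    rw [real_inner_self_eq_norm_sq]
    ring
  -- The function vanishes at s = 0 because the residual does, so its mean slope is its value at s =
  -- 1.
  obtain ⟨s, hs, hs'⟩ := exists_hasDerivAt_eq_slope _ _ zero_lt_one
    (fun s hs => (hD s hs).continuousAt.continuousWithinAt)
    (fun s hs => hD s (Ioo_subset_Icc_self hs))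
  rw [h1] at hs'
  simp only [zero_smul, add_zero, hy, sub_self, inner_zero_left, mul_zero, sub_zero, div_one] at hs'
  rw [← hs']
  exact hc s (Ioo_subset_Icc_self hs)

end LeastSquares

/-! ### Consequences of the restricted isometry property -/

section RestrictedIsometry

variable {d k m : ℕ} {ρ : ℝ → ℝ} {η μ γ R : ℝ} {α : Fin m → Loc d → ℂ}

theorem measOp_phi_eq_spikeSum (α : Fin m → Loc d → ℂ) (θ : Param k d) :
    measOp α (phi θ) = spikeSum (spikeMeas α) θ := measOp_phi α θ

/-- A single unit spike is a difference of admissible sums and has kernel norm 1, so 1 - γ ≤ 1 + γ.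
-/
theorem HasRIP.gamma_nonneg (h : HasRIP α ρ (sepSpikes k d R η) γ) (h0 : ρ 0 = 1) (i : Fin k)
    {θ : Param k d} (hθ : θ ∈ sepParams k d R η) : 0 ≤ γ := by
  set θ₁ : Param k d := WithLp.toLp 2 (EuclideanSpace.single i 1, θ.snd) with h1
  set θ₂ : Param k d := WithLp.toLp 2 (0, θ.snd) with h2
  have hx : phi θ₁ - phi θ₂ = dipole 1 0 (θ.snd i) (θ.snd i) := by
    rw [phi_sub_phi, Finset.sum_eq_single i]
    · simp [h1, h2]
    · intro j _ hj
      simp [h1, h2, dipole, hj]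
    · simp
  have := h _ ⟨θ₁, hθ, rfl⟩ _ ⟨θ₂, hθ, rfl⟩
  rw [hx, kernelNormSq_dipole h0] at this
  simp only [dipoleSq, sub_self, norm_zero, h0] at this
  linarith [this.1.trans this.2]

/-- Two separated unit spikes, seen as degenerate dipoles, have norm 1, so μ dominates an absolute
value. -/
theorem MutualCoherence.mu_nonneg (h : MutualCoherence ρ d η μ) (h0 : ρ 0 = 1) (hη : 0 ≤ η)
    {t s : Loc d} (hts : η < ‖t - s‖) : 0 ≤ μ := by
  have := h.abs_le h0 1 0 1 0 (t := t) (s := t) (t' := s) (s' := s) (by simpa) (by simpa)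
    hts hts hts hts
  simp only [dipoleSq, sub_self, norm_zero, h0] at this
  norm_num at this
  exact (abs_nonneg _).trans this

/-- The parameters with locations in the interior of the ball and at distance more than `η`. -/
def interiorParams (k d : ℕ) (R η : ℝ) : Set (Param k d) :=
  {θ | (∀ i, θ.snd i ∈ interior (Metric.closedBall (0 : Loc d) R)) ∧
    ∀ i j, i ≠ j → η < ‖θ.snd i - θ.snd j‖}

theorem interiorParams_subset : interiorParams k d R η ⊆ sepParams k d R η :=
  fun _ h => ⟨fun i => mem_closedBall_zero_iff.1 (interior_subset (h.1 i)), h.2⟩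

theorem HasRIP.norm_spikeSum_sub (h : HasRIP α ρ (sepSpikes k d R η) γ)
    {θ ξ : Param k d} (hθ : θ ∈ sepParams k d R η) (hξ : ξ ∈ sepParams k d R η) :
    (1 - γ) * kernelNormSq ρ (phi θ - phi ξ)
      ≤ ‖spikeSum (spikeMeas α) θ - spikeSum (spikeMeas α) ξ‖ ^ 2 ∧
    ‖spikeSum (spikeMeas α) θ - spikeSum (spikeMeas α) ξ‖ ^ 2
      ≤ (1 + γ) * kernelNormSq ρ (phi θ - phi ξ) := by
  have := h _ ⟨θ, hθ, rfl⟩ _ ⟨ξ, hξ, rfl⟩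
  rwa [measOp_phi_sub, measOp_phi_eq_spikeSum, measOp_phi_eq_spikeSum] at this

/-- The restricted isometry property in terms of the kernel norms of separated dipoles. -/
theorem HasRIP.norm_spikeSum_sub_of_separated (h : HasRIP α ρ (sepSpikes k d R η) γ)
    (hμ : MutualCoherence ρ d η μ) (h0 : ρ 0 = 1) (hρ : ∀ t s : Loc d, |kernel ρ t s| ≤ 1)
    (hμ0 : 1 < k → 0 ≤ μ) (hγ : γ < 1) (hγ0 : 0 ≤ γ)
    {θ ξ : Param k d} (hθ : θ ∈ sepParams k d R η) (hξ : ξ ∈ sepParams k d R η)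
    (h1 : ∀ i, ‖θ.snd i - ξ.snd i‖ ≤ η) (h2 : ∀ i j, i ≠ j → η < ‖θ.snd i - ξ.snd j‖) :
    (1 - γ) * (1 - ((k : ℝ) - 1) * μ) *
        ∑ i, dipoleSq ρ (θ.fst i) (ξ.fst i) ‖θ.snd i - ξ.snd i‖
      ≤ ‖spikeSum (spikeMeas α) θ - spikeSum (spikeMeas α) ξ‖ ^ 2 ∧
    ‖spikeSum (spikeMeas α) θ - spikeSum (spikeMeas α) ξ‖ ^ 2
      ≤ (1 + γ) * (1 + ((k : ℝ) - 1) * μ) *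
        ∑ i, dipoleSq ρ (θ.fst i) (ξ.fst i) ‖θ.snd i - ξ.snd i‖ := by
  obtain ⟨e1, e2⟩ := h.norm_spikeSum_sub hθ hξ
  obtain ⟨e3, e4⟩ := abs_le.1 (abs_kernelNormSq_phi_sub_le hμ h0 hρ hμ0 h1 hθ.2 hξ.2 h2)
  refine ⟨le_trans ?_ e1, e2.trans ?_⟩
  · rw [mul_assoc]
    exact mul_le_mul_of_nonneg_left (by linarith) (by linarith)
  · rw [mul_assoc]
    exact mul_le_mul_of_nonneg_left (by linarith) (by linarith)

end RestrictedIsometry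

/-! ### Infinitesimal dipoles: the RIP for derivatives -/

section Limits

variable {d k m : ℕ} {ρ : ℝ → ℝ} {η μ γ R : ℝ} {α : Fin m → Loc d → ℂ}

/-- One use of l'Hôpital turns the quotient into a difference quotient of ρ' at 0, whose limit is
governed by ρ''(0). -/
theorem tendsto_one_sub_profile_div_sq (hρ : ContDiff ℝ 2 ρ) (h0 : ρ 0 = 1) (h1 : deriv ρ 0 = 0)
    (r : ℝ) : Tendsto (fun s => (1 - ρ (s * r)) / s ^ 2) (𝓝[>] 0)
      (𝓝 (-deriv (deriv ρ) 0 / 2 * r ^ 2)) := by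
  have hlin : ∀ s, HasDerivAt (fun s : ℝ => s * r) r s := fun s => by
    simpa using (hasDerivAt_id s).mul_const r
  have hd1 : Differentiable ℝ ρ := hρ.differentiable (by norm_num)
  have hd2 : Differentiable ℝ (deriv ρ) :=
    ((contDiff_succ_iff_deriv (n := 1)).1 hρ).2.2.differentiable (by norm_num)
  refine HasDerivAt.lhopital_zero_nhdsGT (f' := fun s => -(deriv ρ (s * r) * r))
    (g' := fun s => 2 * s) ?_ ?_ ?_ ?_ ?_ ?_
  · exact .of_forall fun s => ((hd1 _).hasDerivAt.comp s (hlin s)).const_sub 1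
  · exact .of_forall fun s => by simpa using hasDerivAt_pow 2 s
  · filter_upwards [self_mem_nhdsWithin] with s hs
    have : (0 : ℝ) < s := hs
    positivity
  · have : Continuous fun s => 1 - ρ (s * r) := by
      have := hd1.continuous
      fun_prop
    have h := this.tendsto 0
    simp only [zero_mul, h0, sub_self] at h
    exact h.mono_left nhdsWithin_le_nhds
  · have h := (continuous_pow 2 (M := ℝ)).tendsto 0
    simp only [ne_eq, OfNat.ofNat_ne_zero, not_false_eq_true, zero_pow] at h
    exact h.mono_left nhdsWithin_le_nhds
  · have hD : HasDerivAt (fun s : ℝ => deriv ρ (s * r)) (deriv (deriv ρ) (0 * r) * r) 0 :=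
      (hd2 _).hasDerivAt.comp 0 (hlin 0)
    have h2 := (hasDerivAt_iff_tendsto_slope_zero.1 hD).mono_left
      (nhdsWithin_mono 0 (s := Ioi 0) fun x hx => ne_of_gt hx)
    simp only [zero_add, zero_mul, h1, sub_zero, smul_eq_mul] at h2
    convert h2.mul_const (-r / 2) using 1
    · ext s
      rw [inv_mul_eq_div]
      ring
    · congr 1
      ring

theorem tendsto_dipoleSq_div_sq (hρ : ContDiff ℝ 2 ρ) (h0 : ρ 0 = 1) (h1 : deriv ρ 0 = 0)
    (a b : ℝ) (u : Loc d) :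
    Tendsto (fun s : ℝ => dipoleSq ρ (a + s * b) a ‖s • u‖ / s ^ 2) (𝓝[>] 0)
      (𝓝 (b ^ 2 + a ^ 2 * -deriv (deriv ρ) 0 * ‖u‖ ^ 2)) := by
  have h2 := tendsto_one_sub_profile_div_sq hρ h0 h1 ‖u‖
  have h3 : Tendsto (fun s : ℝ => 2 * ((a + s * b) * a)) (𝓝[>] 0) (𝓝 (2 * ((a + 0 * b) * a))) := by
    have : Continuous fun s : ℝ => 2 * ((a + s * b) * a) := by fun_prop
    exact (this.tendsto 0).mono_left nhdsWithin_le_nhds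
  have h4 := (h3.mul h2).const_add (b ^ 2)
  have e : b ^ 2 + 2 * ((a + 0 * b) * a) * (-deriv (deriv ρ) 0 / 2 * ‖u‖ ^ 2)
      = b ^ 2 + a ^ 2 * -deriv (deriv ρ) 0 * ‖u‖ ^ 2 := by ring
  rw [e] at h4
  refine h4.congr' ?_
  filter_upwards [self_mem_nhdsWithin] with s hs
  have hs0 : (0 : ℝ) < s := hs
  rw [norm_smul, Real.norm_of_nonneg hs0.le, dipoleSq]
  field_simp
  ring

theorem continuous_norm_add_smul (t u : Loc d) : Continuous fun s : ℝ => ‖t + s • u‖ := by fun_prop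

theorem eventually_lt_norm_add_smul {t : Loc d} (u : Loc d) (h : η < ‖t‖) :
    ∀ᶠ s in 𝓝 (0 : ℝ), η < ‖t + s • u‖ := by
  have hc := (continuous_norm_add_smul t u).tendsto 0
  rw [zero_smul, add_zero] at hc
  exact hc.eventually_const_lt h

theorem eventually_norm_smul_le (hη : 0 < η) (u : Loc d) :
    ∀ᶠ s in 𝓝 (0 : ℝ), ‖s • u‖ ≤ η := by
  have hc := (continuous_norm_add_smul 0 u).tendsto 0
  simp only [zero_smul, zero_add, norm_zero] at hc
  exact (hc.eventually_lt_const hη).mono fun s hs => hs.le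

theorem eventually_mem_interiorParams {θ : Param k d} (hθ : θ ∈ interiorParams k d R η)
    (v : Param k d) : ∀ᶠ s in 𝓝[>] (0 : ℝ), θ + s • v ∈ interiorParams k d R η := by
  refine Filter.Eventually.filter_mono nhdsWithin_le_nhds ?_
  simp only [interiorParams, mem_ofPred_eq, snd_add_smul, eventually_and, eventually_all]
  refine ⟨fun i => ?_, fun i j hij => ?_⟩
  · have hc : Continuous fun s : ℝ => θ.snd i + s • v.snd i := by fun_prop
    have h := hc.tendsto 0
    rw [zero_smul, add_zero] at h
    exact h.eventually_mem (isOpen_interior.mem_nhds (hθ.1 i))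
  · refine (eventually_lt_norm_add_smul (v.snd i - v.snd j) (hθ.2 i j hij)).mono fun s hs => ?_
    rwa [add_sub_add_comm, ← smul_sub]

theorem eventually_separated {θ : Param k d} (hθ : θ ∈ interiorParams k d R η) (hη : 0 < η)
    (v : Param k d) : ∀ᶠ s in 𝓝[>] (0 : ℝ), (∀ i, ‖(θ + s • v).snd i - θ.snd i‖ ≤ η) ∧
      ∀ i j, i ≠ j → η < ‖(θ + s • v).snd i - θ.snd j‖ := by
  refine Filter.Eventually.filter_mono nhdsWithin_le_nhds ?_
  simp only [snd_add_smul, add_sub_cancel_left, eventually_and, eventually_all]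
  refine ⟨fun i => eventually_norm_smul_le hη _, fun i j hij => ?_⟩
  refine (eventually_lt_norm_add_smul (v.snd i) (hθ.2 i j hij)).mono fun s hs => ?_
  rwa [add_sub_right_comm]

theorem tendsto_norm_sq_spikeSum_slope {E : Type*} [NormedAddCommGroup E] [NormedSpace ℝ E]
    {f : Loc d → E} {θ : Param k d} (hf : ∀ i, DifferentiableAt ℝ f (θ.snd i)) (v : Param k d) :
    Tendsto (fun s : ℝ => ‖spikeSum f (θ + s • v) - spikeSum f θ‖ ^ 2 / s ^ 2) (𝓝[>] 0)
      (𝓝 (‖spikeSumDeriv f θ v‖ ^ 2)) := by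
  have h2 := hasDerivAt_spikeSum (f := f) (θ := θ) (v := v) (s := 0) (by simpa using hf)
  have h3 := ((hasDerivAt_iff_tendsto_slope_zero.1 h2).mono_left
      (nhdsWithin_mono 0 (s := Ioi 0) fun x hx => ne_of_gt hx)).norm.pow 2
  simp only [zero_add, zero_smul, add_zero] at h3
  refine h3.congr fun s => ?_
  rw [norm_smul, mul_pow, norm_inv, Real.norm_eq_abs, inv_pow, sq_abs, inv_mul_eq_div]

theorem tendsto_sum_dipoleSq_div_sq (hρ : ContDiff ℝ 2 ρ) (h0 : ρ 0 = 1) (h1 : deriv ρ 0 = 0)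
    (θ v : Param k d) :
    Tendsto (fun s : ℝ => (∑ i, dipoleSq ρ ((θ + s • v).fst i) (θ.fst i)
        ‖(θ + s • v).snd i - θ.snd i‖) / s ^ 2) (𝓝[>] 0)
      (𝓝 (∑ i, (v.fst i ^ 2 + θ.fst i ^ 2 * -deriv (deriv ρ) 0 * ‖v.snd i‖ ^ 2))) := by
  simp only [fst_add_smul, snd_add_smul, add_sub_cancel_left, Finset.sum_div]
  exact tendsto_finsetSum _ fun i _ => tendsto_dipoleSq_div_sq hρ h0 h1 _ _ _

/-- Restricted isometry for the directional derivatives of the measurements. -/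
theorem HasRIP.norm_spikeSumDeriv (h : HasRIP α ρ (sepSpikes k d R η) γ)
    (hμ : MutualCoherence ρ d η μ) (hρ2 : ContDiff ℝ 2 ρ) (h0 : ρ 0 = 1) (h1 : deriv ρ 0 = 0)
    (hρ : ∀ t s : Loc d, |kernel ρ t s| ≤ 1)
    (hμ0 : 1 < k → 0 ≤ μ) (hγ : γ < 1) (hγ0 : 0 ≤ γ) (hη : 0 < η)
    {θ : Param k d} (hθ : θ ∈ interiorParams k d R η)
    (hf : ∀ i, DifferentiableAt ℝ (spikeMeas α) (θ.snd i)) (v : Param k d) :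
    (1 - γ) * (1 - ((k : ℝ) - 1) * μ) *
        ∑ i, (v.fst i ^ 2 + θ.fst i ^ 2 * -deriv (deriv ρ) 0 * ‖v.snd i‖ ^ 2)
      ≤ ‖spikeSumDeriv (spikeMeas α) θ v‖ ^ 2 ∧
    ‖spikeSumDeriv (spikeMeas α) θ v‖ ^ 2
      ≤ (1 + γ) * (1 + ((k : ℝ) - 1) * μ) *
        ∑ i, (v.fst i ^ 2 + θ.fst i ^ 2 * -deriv (deriv ρ) 0 * ‖v.snd i‖ ^ 2) := by
  -- For small s, φ(θ + sv) - φ(θ) is a sum of short separated dipoles; dividing its RIP by s² and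
  -- letting s → 0 gives both bounds.
  have hev := ((eventually_mem_interiorParams hθ v).and (eventually_separated hθ hη v)).mono
    fun s hs => h.norm_spikeSum_sub_of_separated hμ h0 hρ hμ0 hγ hγ0 (interiorParams_subset hs.1)
      (interiorParams_subset hθ) hs.2.1 hs.2.2
  have hS := tendsto_sum_dipoleSq_div_sq hρ2 h0 h1 θ v
  have hF := tendsto_norm_sq_spikeSum_slope hf v
  refine ⟨le_of_tendsto_of_tendsto (hS.const_mul _) hF ?_,
    le_of_tendsto_of_tendsto hF (hS.const_mul _) ?_⟩
  · filter_upwards [hev] with s hs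
    rw [← mul_div_assoc]
    exact div_le_div_of_nonneg_right hs.1 (sq_nonneg s)
  · filter_upwards [hev] with s hs
    rw [← mul_div_assoc]
    exact div_le_div_of_nonneg_right hs.2 (sq_nonneg s)

/-- Restricted isometry bounds the derivative of the measurements of a single spike. -/
theorem HasRIP.norm_fderiv_spikeMeas_le (h : HasRIP α ρ (sepSpikes k d R η) γ)
    (hρ2 : ContDiff ℝ 2 ρ) (h0 : ρ 0 = 1) (h1 : deriv ρ 0 = 0)
    {θ : Param k d} (hθ : θ ∈ interiorParams k d R η)
    (hf : ∀ i, DifferentiableAt ℝ (spikeMeas α) (θ.snd i)) (i : Fin k) (u : Loc d) :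
    ‖fderiv ℝ (spikeMeas α) (θ.snd i) u‖ ^ 2 ≤ (1 + γ) * -deriv (deriv ρ) 0 * ‖u‖ ^ 2 := by
  -- Only spike i has nonzero amplitude and only it moves, so the secant is a single dipole and no
  -- coherence factor enters; the idle locations keep the parameter admissible.
  set ξ : Param k d := WithLp.toLp 2 (EuclideanSpace.single i 1, θ.snd) with hξ
  set v : Param k d := WithLp.toLp 2 (0, WithLp.toLp 2 (Pi.single i u)) with hv
  have hξi : ξ ∈ interiorParams k d R η := hθ
  have hξ1 : ∀ j, ξ.fst j = if j = i then 1 else 0 := fun j => by simp [hξ]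
  have hv1 : ∀ j, v.fst j = 0 := fun j => by simp [hv]
  have hv2 : ∀ j, v.snd j = if j = i then u else 0 := fun j => by simp [hv]
  have hD : spikeSumDeriv (spikeMeas α) ξ v = fderiv ℝ (spikeMeas α) (θ.snd i) u := by
    rw [spikeSumDeriv, Finset.sum_eq_single i]
    · simp [hv1, hv2, hξ]
    · intro j _ hj
      simp [hξ1, hv1, hj]
    · simp
  have hS := tendsto_dipoleSq_div_sq hρ2 h0 h1 1 0 u
  have hF := tendsto_norm_sq_spikeSum_slope (θ := ξ) hf v
  rw [hD] at hF
  have e : (1 + γ) * -deriv (deriv ρ) 0 * ‖u‖ ^ 2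
      = (1 + γ) * (0 ^ 2 + 1 ^ 2 * -deriv (deriv ρ) 0 * ‖u‖ ^ 2) := by ring
  rw [e]
  refine le_of_tendsto_of_tendsto hF (hS.const_mul _) ?_
  filter_upwards [eventually_mem_interiorParams hξi v] with s hs
  rw [← mul_div_assoc]
  refine div_le_div_of_nonneg_right ?_ (sq_nonneg s)
  have := (h.norm_spikeSum_sub (interiorParams_subset hs) (interiorParams_subset hξi)).2
  have hx : phi (ξ + s • v) - phi ξ = dipole 1 1 (θ.snd i + s • u) (θ.snd i) := by
    rw [phi_sub_phi, Finset.sum_eq_single i]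
    · simp only [fst_add_smul, snd_add_smul, hξ1, hv1, hv2]
      simp [hξ]
    · intro j _ hj
      simp only [fst_add_smul, snd_add_smul, hξ1, hv1, hv2]
      simp [hj, dipole]
    · simp
  rw [hx, kernelNormSq_dipole h0, add_sub_cancel_left] at this
  simpa using this

end Limits

/-! ### Second derivatives of the measurement functions -/

section SecondDerivative

variable {d m : ℕ} {R : ℝ} {α : Fin m → Loc d → ℂ}

theorem contDiffAt_spikeMeas (hα : ∀ l, ContDiffOn ℝ 2 (α l) (Metric.closedBall 0 R)) {t : Loc d}
    (ht : t ∈ interior (Metric.closedBall (0 : Loc d) R)) : ContDiffAt ℝ 2 (spikeMeas α) t := by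
  rw [contDiffAt_piLp]
  exact fun l => (hα l).contDiffAt (mem_interior_iff_mem_nhds.1 ht)

theorem le_secondDerivBound (hα : ∀ l, ContDiffOn ℝ 2 (α l) (Metric.closedBall 0 R)) {t : Loc d}
    (ht : t ∈ interior (Metric.closedBall (0 : Loc d) R)) (l : Fin m) {v w : Loc d}
    (hv : ‖v‖ = 1) (hw : ‖w‖ = 1) :
    ‖iteratedFDeriv ℝ 2 (α l) t ![v, w]‖ ≤ secondDerivBound α R := by
  have hu : UniqueDiffOn ℝ (Metric.closedBall (0 : Loc d) R) :=
    uniqueDiffOn_convex (convex_closedBall _ _) ⟨t, ht⟩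
  -- Compactness makes the set bounded above, without which the real `sSup` would carry no
  -- information.
  have hb : ∀ l, ∃ C, ∀ t ∈ Metric.closedBall (0 : Loc d) R,
      ‖iteratedFDerivWithin ℝ 2 (α l) (Metric.closedBall 0 R) t‖ ≤ C := fun l =>
    (isCompact_closedBall _ _).exists_bound_of_continuousOn
      ((hα l).continuousOn_iteratedFDerivWithin (by norm_num) hu)
  choose C hC using hb
  rw [← iteratedFDerivWithin_eq_iteratedFDeriv hu
    ((hα l).contDiffAt (mem_interior_iff_mem_nhds.1 ht)) (interior_subset ht)]
  refine le_csSup ⟨∑ l, |C l|, ?_⟩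
    ⟨l, t, v, w, mem_closedBall_zero_iff.1 (interior_subset ht), hv, hw, rfl⟩
  rintro x ⟨l, t, v, w, ht, hv, hw, rfl⟩
  refine (ContinuousMultilinearMap.le_opNorm _ _).trans ?_
  rw [Fin.prod_univ_two]
  simp only [Matrix.cons_val_zero, Matrix.cons_val_one, hv, hw, mul_one]
  refine (hC l t (mem_closedBall_zero_iff.2 ht)).trans ((le_abs_self _).trans ?_)
  exact Finset.single_le_sum (f := fun l => |C l|) (fun i _ => abs_nonneg _) (Finset.mem_univ l)

theorem secondDerivBound_nonneg (α : Fin m → Loc d → ℂ) (R : ℝ) : 0 ≤ secondDerivBound α R := by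
  refine Real.sSup_nonneg ?_
  rintro x ⟨l, t, v, w, -, -, -, rfl⟩
  exact norm_nonneg _

theorem norm_fderiv_fderiv_le (hα : ∀ l, ContDiffOn ℝ 2 (α l) (Metric.closedBall 0 R)) {t : Loc d}
    (ht : t ∈ interior (Metric.closedBall (0 : Loc d) R)) (l : Fin m) (u : Loc d) :
    ‖fderiv ℝ (fderiv ℝ (α l)) t u u‖ ≤ secondDerivBound α R * ‖u‖ ^ 2 := by
  rcases eq_or_ne u 0 with rfl | hu
  · simp
  · have hn : ‖‖u‖⁻¹ • u‖ = 1 := by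
      rw [norm_smul, norm_inv, norm_norm, inv_mul_cancel₀ (norm_ne_zero_iff.2 hu)]
    have h := le_secondDerivBound hα ht l hn hn
    rw [iteratedFDeriv_two_apply] at h
    simp only [Matrix.cons_val_zero, Matrix.cons_val_one, map_smul,
      smul_apply, smul_smul, norm_smul, norm_mul, norm_inv, norm_norm] at h
    have hp : 0 < ‖u‖ := norm_pos_iff.2 hu
    have h2 := mul_le_mul_of_nonneg_right h (sq_nonneg ‖u‖)
    refine le_trans (le_of_eq ?_) h2
    field_simp

theorem norm_fderiv_fderiv_spikeMeas_le
    (hα : ∀ l, ContDiffOn ℝ 2 (α l) (Metric.closedBall 0 R)) {t : Loc d}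
    (ht : t ∈ interior (Metric.closedBall (0 : Loc d) R)) (u : Loc d) :
    ‖fderiv ℝ (fderiv ℝ (spikeMeas α)) t u u‖ ≤ √m * secondDerivBound α R * ‖u‖ ^ 2 := by
  have hc : ∀ l, (fderiv ℝ (fderiv ℝ (spikeMeas α)) t u u) l = fderiv ℝ (fderiv ℝ (α l)) t u u := by
    intro l
    have h := ContinuousLinearMap.iteratedFDeriv_comp_left
      (PiLp.proj (𝕜 := ℝ) 2 (fun _ : Fin m => ℂ) l) (contDiffAt_spikeMeas hα ht) (i := 2)
      (by norm_num)
    have h2 := congrArg (fun T => T ![u, u]) h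
    simp only [ContinuousLinearMap.compContinuousMultilinearMap_coe, Function.comp_apply,
      iteratedFDeriv_two_apply] at h2
    exact h2.symm
  have hD := secondDerivBound_nonneg α R
  refine le_of_sq_le_sq ?_ (by positivity)
  rw [EuclideanSpace.norm_sq_eq]
  calc ∑ l, ‖(fderiv ℝ (fderiv ℝ (spikeMeas α)) t u u) l‖ ^ 2
      ≤ ∑ _l : Fin m, (secondDerivBound α R * ‖u‖ ^ 2) ^ 2 := by
        refine Finset.sum_le_sum fun l _ => ?_
        rw [hc]
        exact pow_le_pow_left₀ (norm_nonneg _) (norm_fderiv_fderiv_le hα ht l u) 2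
    _ = _ := by
        rw [Finset.sum_const, Finset.card_univ, Fintype.card_fin, nsmul_eq_mul, mul_assoc,
          mul_pow √(m : ℝ), Real.sq_sqrt (Nat.cast_nonneg m)]

end SecondDerivative

/-! ### Estimates on a ball around the minimizer -/

section Estimates

variable {d k m : ℕ} {E : Type*} [NormedAddCommGroup E]

theorem norm_spikeSumDeriv2_le [NormedSpace ℝ E] {f : Loc d → E} {θ : Param k d} {M : ℝ}
    (hM : 0 ≤ M) (h1 : ∀ i u, ‖fderiv ℝ f (θ.snd i) u‖ ≤ M * ‖u‖)
    (h2 : ∀ i u, |θ.fst i| * ‖fderiv ℝ (fderiv ℝ f) (θ.snd i) u u‖ ≤ 3 / 2 * M * ‖u‖ ^ 2)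
    (v : Param k d) : ‖spikeSumDeriv2 f θ v‖ ≤ 2 * M * ‖v‖ ^ 2 := by
  rw [norm_sq_param, ← Finset.sum_add_distrib, Finset.mul_sum]
  refine (norm_sum_le _ _).trans (Finset.sum_le_sum fun i _ => ?_)
  refine (norm_add_le _ _).trans ?_
  rw [norm_smul, norm_smul, Real.norm_eq_abs, Real.norm_eq_abs, abs_mul, abs_two]
  have e1 := mul_le_mul_of_nonneg_left (h1 i (v.snd i)) (abs_nonneg (v.fst i))
  -- Half of this square is exactly the gap between 2M(x² + z²) and 2Mxz + (3/2)Mz², with x = |v.fst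
  -- i| and z = ‖v.snd i‖.
  have e2 := mul_nonneg hM (sq_nonneg (2 * |v.fst i| - ‖v.snd i‖))
  have e3 := h2 i (v.snd i)
  rw [← sq_abs (v.fst i)]
  nlinarith

theorem norm_gradient_normSq_spikeSum_sub_le [InnerProductSpace ℝ E] {f : Loc d → E} {y : E}
    {θ : Param k d} (h : ∀ i, DifferentiableAt ℝ f (θ.snd i)) {T : ℝ} (hT0 : 0 ≤ T)
    (hT : ∀ v, ‖spikeSumDeriv f θ v‖ ≤ T * ‖v‖) :
    ‖gradient (fun θ => ‖spikeSum f θ - y‖ ^ 2) θ‖ ≤ 2 * T * ‖spikeSum f θ - y‖ := by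
  set G := gradient (fun θ => ‖spikeSum f θ - y‖ ^ 2) θ with hG
  have h1 := inner_gradient_normSq_spikeSum_sub (y := y) h G
  rw [← hG, real_inner_self_eq_norm_sq] at h1
  have h2 := real_inner_le_norm (spikeSum f θ - y) (spikeSumDeriv f θ G)
  have h3 := mul_le_mul_of_nonneg_left (hT G) (norm_nonneg (spikeSum f θ - y))
  rcases eq_or_lt_of_le (norm_nonneg G) with h0 | h0
  · rw [← h0]
    positivity
  · refine le_of_mul_le_mul_right ?_ h0
    nlinarith

theorem sum_dipoleSq_le {ρ : ℝ → ℝ} {r c : ℝ} (hr : 0 ≤ r)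
    (hρ : ∀ t ∈ Icc 0 c, 1 - r / 2 * t ^ 2 ≤ ρ t) {θ ξ : Param k d}
    (h1 : ∀ i, |θ.fst i - ξ.fst i| ≤ |ξ.fst i| / 2) (h2 : ∀ i, ‖θ.snd i - ξ.snd i‖ ≤ c) :
    ∑ i, dipoleSq ρ (θ.fst i) (ξ.fst i) ‖θ.snd i - ξ.snd i‖
      ≤ (1 + 3 / 2 * (r * ‖ξ.fst‖ ^ 2)) * ‖θ - ξ‖ ^ 2 := by
  have hX : 0 ≤ r * ‖ξ.fst‖ ^ 2 := by positivity
  rw [norm_sq_param, ← Finset.sum_add_distrib, Finset.mul_sum]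
  refine Finset.sum_le_sum fun i _ => ?_
  have e1 := hρ _ ⟨norm_nonneg _, h2 i⟩
  -- Amplitudes move by at most half, so their product stays in [1/2, 3/2] times the square; this is
  -- the 3/2 of the conclusion.
  have e2 : |θ.fst i * ξ.fst i - ξ.fst i ^ 2| ≤ ξ.fst i ^ 2 / 2 := by
    have := mul_le_mul_of_nonneg_right (h1 i) (abs_nonneg (ξ.fst i))
    rw [← abs_mul] at this
    rw [← sq_abs (ξ.fst i)]
    calc _ = |(θ.fst i - ξ.fst i) * ξ.fst i| := by rw [sq_abs]; ring_nf
      _ ≤ _ := by linarith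
  obtain ⟨e3, e4⟩ := abs_le.1 e2
  have e5 : ξ.fst i ^ 2 ≤ ‖ξ.fst‖ ^ 2 := by
    rw [EuclideanSpace.norm_sq_eq]
    simpa using Finset.single_le_sum (f := fun i => ξ.fst i ^ 2) (fun i _ => sq_nonneg _)
      (Finset.mem_univ i)
  have e6 : 2 * (θ.fst i * ξ.fst i) * (1 - ρ ‖θ.snd i - ξ.snd i‖)
      ≤ 2 * (3 / 2 * ‖ξ.fst‖ ^ 2) * (r / 2 * ‖θ.snd i - ξ.snd i‖ ^ 2) := by
    have hab : 0 ≤ θ.fst i * ξ.fst i := by nlinarith [sq_nonneg (ξ.fst i)]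
    calc _ ≤ 2 * (θ.fst i * ξ.fst i) * (r / 2 * ‖θ.snd i - ξ.snd i‖ ^ 2) :=
          mul_le_mul_of_nonneg_left (by linarith) (by linarith)
      _ ≤ _ := mul_le_mul_of_nonneg_right (by linarith) (by positivity)
  have e7 : (θ - ξ).fst i = θ.fst i - ξ.fst i := by simp
  have e8 : (θ - ξ).snd i = θ.snd i - ξ.snd i := by simp
  rw [e7, e8, dipoleSq]
  nlinarith [mul_nonneg hX (sq_nonneg (θ.fst i - ξ.fst i)), sq_nonneg ‖θ.snd i - ξ.snd i‖]

theorem le_sum_sq_add {b : Fin k → ℝ} {q : ℝ} (h : ∀ i, q ≤ b i) (hq : q ≤ 1) (v : Param k d) :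
    q * ‖v‖ ^ 2 ≤ ∑ i, (v.fst i ^ 2 + b i * ‖v.snd i‖ ^ 2) := by
  rw [norm_sq_param, ← Finset.sum_add_distrib, Finset.mul_sum]
  refine Finset.sum_le_sum fun i _ => ?_
  rw [mul_add]
  exact add_le_add (mul_le_of_le_one_left (sq_nonneg _) hq)
    (mul_le_mul_of_nonneg_right (h i) (sq_nonneg _))

theorem sum_sq_add_le {b : Fin k → ℝ} {q : ℝ} (h : ∀ i, b i ≤ q) (hq : 0 ≤ q) (v : Param k d) :
    ∑ i, (v.fst i ^ 2 + b i * ‖v.snd i‖ ^ 2) ≤ (1 + q) * ‖v‖ ^ 2 := by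
  rw [norm_sq_param, ← Finset.sum_add_distrib, Finset.mul_sum]
  refine Finset.sum_le_sum fun i _ => ?_
  rw [mul_add]
  refine add_le_add (le_mul_of_one_le_left (sq_nonneg _) (by linarith))
    (mul_le_mul_of_nonneg_right ?_ (sq_nonneg _))
  linarith [h i]

/-- Each location moves by less than ε/4, so a pairwise distance loses less than ε/2. -/
theorem mem_interiorParams_of_ball {R ε β : ℝ} {θ θ' : Param k d} (hθ' : θ' ∈ sepParams k d R ε)
    (hball : ∀ i, Metric.ball (θ'.snd i) β ⊆ Metric.closedBall (0 : Loc d) R) (hβ : β ≤ ε / 4)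
    (hε : 0 < ε)
    (hθ : ‖θ - θ'‖ < β) : θ ∈ interiorParams k d R (ε / 2) ∧
      ∀ i j, i ≠ j → ε / 2 < ‖θ.snd i - θ'.snd j‖ := by
  have h : ∀ i, ‖θ.snd i - θ'.snd i‖ < β := fun i => by
    have := norm_snd_le_norm (θ - θ') i
    rw [WithLp.sub_snd, PiLp.sub_apply] at this
    exact this.trans_lt hθ
  refine ⟨⟨fun i => interior_maximal (hball i) Metric.isOpen_ball (mem_ball_iff_norm.2 (h i)),
    fun i j hij => ?_⟩, fun i j hij => ?_⟩
  · have e1 := hθ'.2 i j hij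
    have e2 : θ'.snd i - θ'.snd j
        = (θ.snd i - θ.snd j) - (θ.snd i - θ'.snd i) + (θ.snd j - θ'.snd j) := by abel
    have e3 := norm_add_le ((θ.snd i - θ.snd j) - (θ.snd i - θ'.snd i)) (θ.snd j - θ'.snd j)
    have e4 := norm_sub_le (θ.snd i - θ.snd j) (θ.snd i - θ'.snd i)
    rw [← e2] at e3
    linarith [h i, h j]
  · have e1 := hθ'.2 i j hij
    have e2 : θ'.snd i - θ'.snd j
        = (θ.snd i - θ'.snd j) - (θ.snd i - θ'.snd i) := by abel
    have e4 := norm_sub_le (θ.snd i - θ'.snd j) (θ.snd i - θ'.snd i)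
    rw [← e2] at e4
    linarith [h i]

end Estimates

/-- The strict slack between the admissible radius and the curvature bounds. -/
theorem radius_slack {d : ℕ} (hd : 0 < d) {β P q g K M X : ℝ} (hβ : 0 < β)
    (hg : 0 < g) (hK : 0 < K) (hM : 0 < M) (hX : 0 < X)
    (h : β ≤ P / (((d : ℝ) + 1) * √g * √K) * (q / (M * √(1 + 2 * X)))) :
    0 < 2 * (P * q - 2 * (√g * √K * √(1 + 3 / 2 * X)) * β * M) := by
  have hd1 : (1 : ℝ) ≤ d := by exact_mod_cast hd
  -- Strictness comes from 3/2 < 2; the factor 2 in the curvature term is absorbed by d + 1 ≥ 2.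
  have h1 : √(1 + 3 / 2 * X) < √(1 + 2 * X) := Real.sqrt_lt_sqrt (by positivity) (by linarith)
  have hg' := Real.sqrt_pos.2 hg
  have hK' := Real.sqrt_pos.2 hK
  have h2 : 0 < √(1 + 2 * X) := Real.sqrt_pos.2 (by positivity)
  rw [div_mul_div_comm, le_div_iff₀ (by positivity)] at h
  have h3 : 2 * (√g * √K * √(1 + 3 / 2 * X)) * β * M < 2 * (√g * √K * √(1 + 2 * X)) * β * M := by
    gcongr
  have h4 : (2 : ℝ) * (√g * √K * √(1 + 2 * X)) * β * M
      ≤ (d + 1) * (√g * √K * √(1 + 2 * X)) * β * M := by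
    gcongr
    linarith
  nlinarith

end SpikeEstimation

/-! ### Assembly of the basin of attraction -/

theorem corollary3
    {k d m : ℕ} (hk : 0 < k) (hd : 0 < d)
    {R ε c_h γ μ : ℝ} (hε : 0 < ε)
    -- the measurement functions are twice continuously differentiable on the closed ball
    (α : Fin m → Loc d → ℂ)
    (hα : ∀ l, ContDiffOn ℝ 2 (α l) (Metric.closedBall 0 R))
    -- the kernel, its mutual coherence, and the restricted isometry property
    (ρ : ℝ → ℝ) (hρ : KernelAssumption ρ d ε c_h)
    (hμ : MutualCoherence ρ d (ε / 2) μ) (hkμ : ((k : ℝ) - 1) * μ < 1)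
    (hRIP : HasRIP α ρ (sepSpikes k d R (ε / 2)) γ) (hγ : γ < 1)
    -- noiseless measurements of a sum of separated spikes
    (x₀ : SignedMeasure (Loc d)) (hx₀ : x₀ ∈ sepSpikes k d R ε)
    (y : EuclideanSpace ℂ (Fin m)) (hy : y = measOp α x₀)
    -- a result of the constrained minimization
    (θ' : Param k d) (hθ' : θ' ∈ sepParams k d R ε)
    (hmin : IsMinOn (objective α y) (sepParams k d R ε) θ')
    (hint : ∀ i, θ'.snd i ∈ interior (Metric.closedBall (0 : Loc d) R))
    (ha_pos : 0 < |θ'.fst ⟨0, hk⟩|) (ha_mono : Monotone fun i => |θ'.fst i|)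
    -- the radius is admissible for the uniform control of the Hessian
    (hβ : betaMax hk α R ρ γ μ c_h θ' ≤ ε / 4)
    (hball : ∀ i, Metric.ball (θ'.snd i) (betaMax hk α R ρ γ μ c_h θ') ⊆
      Metric.closedBall (0 : Loc d) R) :
    IsBasinOfAttraction (objective α y)
      (Metric.ball θ' (betaMax hk α R ρ γ μ c_h θ')) θ' := by
  obtain ⟨hρ2, -, h0, hρ1, h1, hneg, hc0, -, hge⟩ := hρ
  have hη : 0 < ε / 2 := by positivity
  set r := |deriv (deriv ρ) 0| with hr_def
  have hr : r = -deriv (deriv ρ) 0 := abs_of_neg hneg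
  have hr0 : 0 < r := by rw [hr]; linarith
  have hθs : θ' ∈ sepParams k d R (ε / 2) :=
    ⟨hθ'.1, fun i j hij => lt_trans (by linarith) (hθ'.2 i j hij)⟩
  have hγ0 : 0 ≤ γ := hRIP.gamma_nonneg h0 ⟨0, hk⟩ hθs
  have hμ0 : 1 < k → 0 ≤ μ := fun hk1 => hμ.mu_nonneg h0 hη.le
    (hθs.2 ⟨0, hk⟩ ⟨1, hk1⟩ (by simp))
  have hK1 : 0 ≤ ((k : ℝ) - 1) * μ := by
    rcases Nat.lt_or_ge 1 k with hk1 | hk1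
    · exact mul_nonneg (by have : (1 : ℝ) ≤ k := by exact_mod_cast hk
                           linarith) (hμ0 hk1)
    · obtain rfl : k = 1 := by omega
      simp
  -- the residual vanishes at `θ'`
  have hobj : objective α y = fun θ : Param k d => ‖spikeSum (spikeMeas α) θ - y‖ ^ 2 := by
    funext θ
    rw [objective, measOp_phi_eq_spikeSum]
  have hres : spikeSum (spikeMeas α) θ' = y := by
    obtain ⟨θ₀, hθ₀, rfl⟩ := hx₀
    -- The true parameter is feasible with objective 0, which forces the minimal value to be 0.
    have h := isMinOn_iff.1 hmin θ₀ hθ₀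
    rw [hobj] at h
    simp only [hy, measOp_phi_eq_spikeSum, sub_self, norm_zero] at h ⊢
    rw [← sub_eq_zero, ← norm_eq_zero]
    exact pow_eq_zero_iff (two_ne_zero) |>.1 (le_antisymm (by simpa using h) (sq_nonneg _))
  rw [hobj]
  -- the constants
  set a₁ := |θ'.fst ⟨0, hk⟩| with ha₁
  set A := |θ'.fst ⟨k - 1, Nat.sub_lt hk Nat.one_pos⟩|
  set X := r * ‖θ'.fst‖ ^ 2 with hX
  set P := (1 - γ) * (1 - ((k : ℝ) - 1) * μ)
  set K := 1 + ((k : ℝ) - 1) * μ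
  set M := max (A * √m * secondDerivBound α R) (√(1 + γ) * √r)
  set q := min 1 (a₁ ^ 2 * r / 4)
  set β := betaMax hk α R ρ γ μ c_h θ' with hβdef
  have hlow : ∀ i, a₁ ≤ |θ'.fst i| := fun i => ha_mono (Fin.mk_le_of_le_val (Nat.zero_le _))
  have hupp : ∀ i, |θ'.fst i| ≤ A := fun i => ha_mono (Fin.le_def.2 (Nat.le_sub_one_of_lt i.2))
  have hX0 : 0 < X := by
    have : θ'.fst ≠ 0 := fun h => by
      rw [h] at ha₁
      simp [ha₁] at ha_pos
    have := norm_pos_iff.2 this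
    positivity
  have hP0 : 0 < P := mul_pos (by linarith) (by linarith)
  have hK0 : 0 < K := by linarith
  have hg0 : 0 < 1 + γ := by linarith
  have hM0 : 0 < M := lt_max_of_lt_right (mul_pos (Real.sqrt_pos.2 hg0) (Real.sqrt_pos.2 hr0))
  have hq0 : 0 < q := lt_min one_pos (by positivity)
  have hβC : β = min c_h (min (a₁ / 2) (P / (((d : ℝ) + 1) * √(1 + γ) * √K) *
      (q / (M * √(1 + 2 * X))))) := by
    rw [hβdef, betaMax, C₁, C₂, ← hr_def, hX, ← mul_assoc 2]
  have hβ0 : 0 < β := by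
    rw [hβC]
    exact lt_min hc0 (lt_min (by positivity) (by positivity))
  have hβc : β ≤ c_h := hβC ▸ min_le_left _ _
  have hβa : β ≤ a₁ / 2 := hβC ▸ (min_le_right _ _).trans (min_le_left _ _)
  have hβ' : β ≤ P / (((d : ℝ) + 1) * √(1 + γ) * √K) * (q / (M * √(1 + 2 * X))) :=
    hβC ▸ (min_le_right _ _).trans (min_le_right _ _)
  have hslack := radius_slack hd hβ0 hg0 hK0 hM0 hX0 hβ'
  set S := √(1 + γ) * √K * √(1 + 3 / 2 * X) with hS
  have hS0 : 0 ≤ S := by positivity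
  -- properties of the parameters in the ball
  have hmem : ∀ θ : Param k d, ‖θ - θ'‖ < β → θ ∈ interiorParams k d R (ε / 2) ∧
      ∀ i j, i ≠ j → ε / 2 < ‖θ.snd i - θ'.snd j‖ :=
    fun θ hθ => mem_interiorParams_of_ball hθ' hball hβ hε hθ
  have hsm : ∀ θ : Param k d, ‖θ - θ'‖ < β → ∀ i, ContDiffAt ℝ 2 (spikeMeas α) (θ.snd i) :=
    fun θ hθ i => contDiffAt_spikeMeas hα ((hmem θ hθ).1.1 i)
  have hdf : ∀ θ : Param k d, ‖θ - θ'‖ < β →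
      ∀ i, DifferentiableAt ℝ (spikeMeas α) (θ.snd i) :=
    fun θ hθ i => (hsm θ hθ i).differentiableAt (by norm_num)
  have hamp : ∀ θ : Param k d, ‖θ - θ'‖ < β → ∀ i, |θ.fst i - θ'.fst i| ≤ a₁ / 2 := by
    intro θ hθ i
    have := abs_fst_le_norm (θ - θ') i
    rw [WithLp.sub_fst, PiLp.sub_apply] at this
    linarith
  have hloc : ∀ θ : Param k d, ‖θ - θ'‖ < β → ∀ i, ‖θ.snd i - θ'.snd i‖ ≤ β := by
    intro θ hθ i
    have := norm_snd_le_norm (θ - θ') i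
    rw [WithLp.sub_snd, PiLp.sub_apply] at this
    linarith
  have hF : ∀ θ : Param k d, ‖θ - θ'‖ < β →
      ‖spikeSum (spikeMeas α) θ - y‖ ≤ S * ‖θ - θ'‖ := by
    intro θ hθ
    obtain ⟨e1, e2⟩ := hmem θ hθ
    have e3 := (hRIP.norm_spikeSum_sub_of_separated hμ h0 hρ1 hμ0 hγ hγ0
      (interiorParams_subset e1) hθs (fun i => by linarith [hloc θ hθ i]) e2).2
    rw [hres] at e3
    have e4 := sum_dipoleSq_le hr0.le hge (θ := θ) (ξ := θ')
      (fun i => by linarith [hamp θ hθ i, hlow i]) (fun i => (hloc θ hθ i).trans hβc)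
    refine le_of_sq_le_sq ?_ (by positivity)
    rw [mul_pow, hS, mul_pow, mul_pow, Real.sq_sqrt hg0.le, Real.sq_sqrt hK0.le,
      Real.sq_sqrt (by positivity), mul_assoc]
    exact e3.trans (mul_le_mul_of_nonneg_left e4 (by positivity))
  have hD : ∀ θ : Param k d, ‖θ - θ'‖ < β → ∀ v : Param k d,
      P * ∑ i, (v.fst i ^ 2 + θ.fst i ^ 2 * r * ‖v.snd i‖ ^ 2)
        ≤ ‖spikeSumDeriv (spikeMeas α) θ v‖ ^ 2 ∧
      ‖spikeSumDeriv (spikeMeas α) θ v‖ ^ 2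
        ≤ (1 + γ) * K * ∑ i, (v.fst i ^ 2 + θ.fst i ^ 2 * r * ‖v.snd i‖ ^ 2) := by
    intro θ hθ v
    rw [hr]
    exact hRIP.norm_spikeSumDeriv hμ hρ2 h0 h1 hρ1 hμ0 hγ hγ0 hη (hmem θ hθ).1 (hdf θ hθ) v
  have hD2 : ∀ θ : Param k d, ‖θ - θ'‖ < β → ∀ v,
      ‖spikeSumDeriv2 (spikeMeas α) θ v‖ ≤ 2 * M * ‖v‖ ^ 2 := by
    intro θ hθ v
    refine norm_spikeSumDeriv2_le hM0.le (fun i u => ?_) (fun i u => ?_) v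
    · have e1 := hRIP.norm_fderiv_spikeMeas_le hρ2 h0 h1 (hmem θ hθ).1 (hdf θ hθ) i u
      rw [← hr] at e1
      refine le_trans ?_ (mul_le_mul_of_nonneg_right (le_max_right _ _) (norm_nonneg u))
      refine le_of_sq_le_sq ?_ (by positivity)
      rwa [mul_pow, mul_pow, Real.sq_sqrt hg0.le, Real.sq_sqrt hr0.le]
    · have e1 := norm_fderiv_fderiv_spikeMeas_le hα ((hmem θ hθ).1.1 i) u
      have hDn := secondDerivBound_nonneg α R
      have e2 : |θ.fst i| ≤ 3 / 2 * A := by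
        have := abs_sub_abs_le_abs_sub (θ.fst i) (θ'.fst i)
        linarith [hamp θ hθ i, hlow i, hupp i]
      calc _ ≤ 3 / 2 * A * (√m * secondDerivBound α R * ‖u‖ ^ 2) :=
            mul_le_mul e2 e1 (norm_nonneg _) (by positivity)
        _ = 3 / 2 * (A * √m * secondDerivBound α R) * ‖u‖ ^ 2 := by ring
        _ ≤ _ := by
          gcongr
          exact le_max_left _ _
  have hH : ∀ θ : Param k d, ‖θ - θ'‖ < β → ∀ v,
      2 * (P * q - 2 * S * β * M) * ‖v‖ ^ 2 ≤ 2 * ‖spikeSumDeriv (spikeMeas α) θ v‖ ^ 2 +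
        2 * inner ℝ (spikeSum (spikeMeas α) θ - y) (spikeSumDeriv2 (spikeMeas α) θ v) := by
    intro θ hθ v
    have e1 := (hD θ hθ v).1
    have e2 : q * ‖v‖ ^ 2 ≤ ∑ i, (v.fst i ^ 2 + θ.fst i ^ 2 * r * ‖v.snd i‖ ^ 2) := by
      refine le_sum_sq_add (fun i => ?_) (min_le_left _ _) v
      -- Amplitudes keep at least half of a₁, whence the a₁²/4 in q.
      have e3 : a₁ / 2 ≤ |θ.fst i| := by
        have := abs_sub_abs_le_abs_sub (θ'.fst i) (θ.fst i)
        rw [abs_sub_comm] at this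
        linarith [hamp θ hθ i, hlow i]
      have e4 := pow_le_pow_left₀ (by positivity) e3 2
      rw [sq_abs] at e4
      have e5 := mul_le_mul_of_nonneg_right e4 hr0.le
      exact (min_le_right _ _).trans (by linarith)
    have e3 := mul_le_mul_of_nonneg_left e2 hP0.le
    have e4 := (abs_le.1 (abs_real_inner_le_norm (spikeSum (spikeMeas α) θ - y)
      (spikeSumDeriv2 (spikeMeas α) θ v))).1
    have e5 : ‖spikeSum (spikeMeas α) θ - y‖ * ‖spikeSumDeriv2 (spikeMeas α) θ v‖
        ≤ S * β * (2 * M * ‖v‖ ^ 2) :=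
      mul_le_mul ((hF θ hθ).trans (mul_le_mul_of_nonneg_left hθ.le hS0)) (hD2 θ hθ v)
        (norm_nonneg _) (by positivity)
    linarith
  -- c is the Hessian lower bound; L is twice the bound on DF times the Lipschitz constant S of the
  -- residual at θ'. The 9/4 is the square of the 3/2 in |a_i| ≤ (3/2)A.
  refine isBasinOfAttraction_ball (c := 2 * (P * q - 2 * S * β * M))
    (L := 2 * (√(1 + γ) * √K * √(1 + 9 / 4 * A ^ 2 * r)) * S) hβ0 hslack ?_ ?_ ?_
  · intro θ hθ
    rw [mem_ball_iff_norm] at hθ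
    exact ((differentiableAt_spikeSum (hdf θ hθ)).sub_const y).norm_sq ℝ
  · intro θ hθ
    rw [mem_ball_iff_norm] at hθ
    have hseg : ∀ s ∈ Icc (0 : ℝ) 1, ‖θ' + s • (θ - θ') - θ'‖ < β := by
      intro s hs
      rw [add_sub_cancel_left, norm_smul, Real.norm_of_nonneg hs.1]
      exact (mul_le_of_le_one_left (norm_nonneg _) hs.2).trans_lt hθ
    exact le_inner_gradient_of_segment hres (fun s hs => hsm _ (hseg s hs))
      (fun s hs => hH _ (hseg s hs) _)
  · intro θ hθ
    rw [mem_ball_iff_norm] at hθ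
    refine (norm_gradient_normSq_spikeSum_sub_le (T := √(1 + γ) * √K * √(1 + 9 / 4 * A ^ 2 * r))
      (hdf θ hθ) (by positivity) fun v => ?_).trans
      ((mul_le_mul_of_nonneg_left (hF θ hθ) (by positivity)).trans (le_of_eq (by ring)))
    have e1 := (hD θ hθ v).2
    have e2 : ∑ i, (v.fst i ^ 2 + θ.fst i ^ 2 * r * ‖v.snd i‖ ^ 2)
        ≤ (1 + 9 / 4 * A ^ 2 * r) * ‖v‖ ^ 2 := by
      refine sum_sq_add_le (fun i => ?_) (by positivity) v
      refine mul_le_mul_of_nonneg_right ?_ hr0.le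
      have e3 : |θ.fst i| ≤ 3 / 2 * A := by
        have := abs_sub_abs_le_abs_sub (θ.fst i) (θ'.fst i)
        linarith [hamp θ hθ i, hlow i, hupp i]
      have e4 := pow_le_pow_left₀ (abs_nonneg _) e3 2
      rw [sq_abs] at e4
      linarith
    refine le_of_sq_le_sq ?_ (by positivity)
    rw [mul_pow, mul_pow, mul_pow, Real.sq_sqrt hg0.le, Real.sq_sqrt hK0.le,
      Real.sq_sqrt (by positivity), mul_assoc]
    exact e1.trans (mul_le_mul_of_nonneg_left e2 (by positivity))
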